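/- Let $\mu\ge 1$, $m\ge 0$ and $\alpha\ge0$ be integers, let $A\subset\mathbb R^{\alpha}$ be open, and put $P_\varepsilon(x)=x(x^{\mu}-\varepsilon)$ for $\varepsilon\in\mathbb R$, with biggest real root $\vartheta_\varepsilon=0$ for $\varepsilon\le 0$ and $\vartheta_\varepsilon=\varepsilon^{1/\mu}$ for $\varepsilon\ge 0$. Let $V_a(x)$ be real analytic in $(x,a)$ for $|x|\le 1$, $a\in A$, with $V_a(0)>0$ for all $a\in A$. Let $U_a(x,y)=x^{m}\bar U_a(x,y)$, where for each $a\in A$ the Taylor series $\bar U_a(x,y)=\sum_{i,j\ge 0}u_{ij}(a)x^iy^j$ converges absolutely on $|x|,|y|\le 1$, the coefficients $u_{ij}$ are continuous on $A$, and $\sum_{i,j}|u_{ij}(a)|$ is bounded on every compact subset of $A$. Consider $$\frac{1}{y\,U_a(x,y)}\bigl(P_\varepsilon(x)\,\partial_x-V_a(x)\,y\,\partial_y\bigr)$$ and let its Dulac time $\mathcal T(s;\varepsilon,a)$ be the time that the trajectory starting at $(s+\vartheta_\varepsilon,1)$ spends, inside $|y|\le1$, to arrive to $\{x=1\}$. (Along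 the trajectory, parametrized by $x\in[s+\vartheta_\varepsilon,1]$, one has $dy/dx=-V_a(x)y/P_\varepsilon(x)$ and $dt/dx=y\,U_a(x,y)/P_\varepsilon(x)$; zeros of $U_a$ on it are allowed.) Then there exist functions $c_j(\varepsilon,a)$, $j\in\mathbb Z_{\ge 0}$, with $c_j(\varepsilon,a)=0$ for $\varepsilon\le 0$, $a\in A$ and $j=0,\dots,m-1$, such that for all integers $\ell,k\ge 0$ and every compact set $K_a\subset A$ there exists $\varepsilon_0>0$ for which the following hold. 1. The functions $c_0,\dots,c_\ell$ are continuous on $[-\varepsilon_0,\varepsilon_0]\times K_a$. 2. There is $s_0>0$ such that, for all $(\varepsilon,a)\in[-\varepsilon_0,\varepsilon_0]\times K_a$, one has $s_0+\vartheta_\varepsilon\le 1$ and the Dulac time is defined for $0<s<s_0$. Wherever it is defined (with $s>0$, $s+\vartheta_\varepsilon\le1$ and these parameters) it is $$\mathcal T(s;\varepsilon,a)=\sum_{j=0}^{\ell}c_j(\varepsilon,a)s^j+s^{\ell}h_\ell(s;\varepsilon,a),$$ where $h_\ell(\cdot\,;\varepsilon,a)$ is of class $C^k$ on $(0,s_0)$.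 3. With $\Theta=s\,\partial_s$, for $r=0,1,\dots,k$, $\Theta^{r}h_\ell(s;\varepsilon,a)\to 0$ as $s\to 0^+$, uniformly on $[-\varepsilon_0,\varepsilon_0]\times K_a$. -/

import Mathlib

open Set Filter Topology

noncomputable section

namespace DulacTime

/-- The polynomial `P_ε(x) = x (x^μ - ε)`. -/
def unfoldingP (μ : ℕ) (ε x : ℝ) : ℝ := x * (x ^ μ - ε)

/-- The biggest real root `ϑ_ε` of `P_ε` : it is `0` for `ε ≤ 0` and `ε ^ (1 / μ)` for `ε ≥ 0`. -/
def bigRoot (μ : ℕ) (ε : ℝ) : ℝ := if ε ≤ 0 then 0 else ε ^ ((1 : ℝ) / (μ : ℝ))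

/-- The trajectory of the vector field
`(1 / (y U(x,y))) (P(x) ∂_x - V(x) y ∂_y)`, i.e. of
`dx/dt = P(x) / (y U(x,y))`, `dy/dt = - V(x) / U(x,y)`,
which starts at time `0` at the point `(x₀, 1)` of the section `{y = 1}` and goes to the section
`{x = 1}` inside the domain `|y| ≤ 1`.
It is described over the interval `[x₀, 1]` of abscissas: `y x` is the ordinate of its point of
abscissa `x` and `t x` is the time at which this point is reached, so that
`dy/dx = - V y / P` and `dt/dx = y U(x,y) / P`.
Zeros of `U`, which are poles of the vector field, are allowed on the trajectory. -/
structure IsPassage (P V : ℝ → ℝ) (U : ℝ → ℝ → ℝ) (x₀ : ℝ) (y t : ℝ → ℝ) : Prop where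
  y_start : y x₀ = 1
  t_start : t x₀ = 0
  abs_y_le : ∀ x ∈ Icc x₀ 1, |y x| ≤ 1
  orbit : ∀ x ∈ Icc x₀ 1, HasDerivWithinAt y (-(V x * y x) / P x) (Icc x₀ 1) x
  time : ∀ x ∈ Icc x₀ 1, HasDerivWithinAt t (y x * U x (y x) / P x) (Icc x₀ 1) x

/-- `τ` is the time which the trajectory of `(1 / (y U)) (P ∂_x - V y ∂_y)` starting at `(x₀, 1)`
spends to arrive to `{x = 1}`. -/
def IsDulacTime (P V : ℝ → ℝ) (U : ℝ → ℝ → ℝ) (x₀ τ : ℝ) : Prop :=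
  ∃ y t : ℝ → ℝ, IsPassage P V U x₀ y t ∧ t 1 = τ

/-- The functions `F_a(x,y)`, `a ∈ A`, have Taylor series `∑ u_{ij}(a) x^i y^j` which converge
absolutely to them on `|x|, |y| ≤ 1`; the dependence on the parameter is such that the
coefficients are continuous on `A` and the norm `∑ |u_{ij}(a)|` is bounded on compact subsets
of `A`. -/
def IsAbsConvTaylorFamily {α : ℕ} (A : Set (EuclideanSpace ℝ (Fin α)))
    (F : EuclideanSpace ℝ (Fin α) → ℝ → ℝ → ℝ) : Prop :=
  ∃ u : ℕ → ℕ → EuclideanSpace ℝ (Fin α) → ℝ,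
    (∀ i j, ContinuousOn (u i j) A) ∧
    (∀ a ∈ A, Summable fun p : ℕ × ℕ => |u p.1 p.2 a|) ∧
    (∀ K ⊆ A, IsCompact K → ∃ M : ℝ, ∀ a ∈ K, ∑' p : ℕ × ℕ, |u p.1 p.2 a| ≤ M) ∧
    ∀ a ∈ A, ∀ x y : ℝ, |x| ≤ 1 → |y| ≤ 1 →
      HasSum (fun p : ℕ × ℕ => u p.1 p.2 a * x ^ p.1 * y ^ p.2) (F a x y)

/-- The differential operator `Θ = s ∂_s`. -/
def eulerOp (f : ℝ → ℝ) : ℝ → ℝ := fun s => s * deriv f s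

end DulacTime

end

/-!
Write `ϑ` for the biggest root of `P = P_ε`, `x = s + ϑ`, and let `y` be the ordinate along the
trajectory starting at `(x, 1)`. The Dulac time is the sum `∑ u_{ij}(a) T_{ij}(s)`, where `T_{ij}` is
the time `∫ x ^ (m + i) y ^ (j + 1) / P dx` due to one monomial of `U`. As a function of the starting
abscissa, `T = T_{ij}` solves a linear equation which is singular at `ϑ`,

  `P T' = (j + 1) V T - g`,  `g = x ^ (m + i)`.

Differentiated `n` times it becomes `P T⁽ⁿ⁺¹⁾ = ((j + 1) V - n P') T⁽ⁿ⁾ - fₙ`, where `fₙ` involves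
only lower derivatives of `T`. Close to `x = 0` and for small `ε`, both `P'` and `P / (x - ϑ)` are
small while `V` is bounded below; hence the weight `(j + 1) V - n P'` is positive, and solutions of
such an equation are bounded by `sup |fₙ| / inf ((j + 1) V - n P')`, up to the influence of the value
at the right end of the interval, which decays like `((x - ϑ) / δ) ^ (j + 1)`
(`abs_le_of_singular_ode`). By induction on `n`, every derivative of `T_{ij}` is bounded near `ϑ`,
uniformly in `i`, `j`, `ε` and `a` (`SingularODE.exists_bound`). These estimates never divide by `P`
near `ϑ`, so that nothing is lost when its roots collide at `ε = 0`.

Consequently the derivatives of `T_{ij}` have limits at `s = 0`, and passing to the limit in the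
differentiated equation gives a recursion for them (`formalDeriv`,
`SingularODE.tendsto_iteratedDeriv`). The coefficients `c_n` are defined by this recursion, summed
against `u_{ij}(a)`. They vanish for `ε ≤ 0` and `n < m` since `x ^ (m + i)` is flat enough at
`ϑ = 0`. For continuity in `(ε, a)` there is only a bound on `∑ |u_{ij}(a)|`, and no uniform
convergence, at hand; but the limits of the derivatives of `T_{ij}` decay as `i` or `j` goes to
infinity, which suffices (`continuousOn_tsum_mul`).

Finally the Dulac time is a function of `s` on `(0, s₀)` with uniformly bounded derivatives of all
orders up to `l + k + 1` (`tower_dulacTime`), which have the limits `n! c_n` at `0`: Taylor's formula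
shows that the remainder of order `l`, divided by `s ^ l`, and its images under `s ∂_s` are `O(s)`
(`remainder_of_tower`).
-/

open scoped ContDiff

namespace DulacTime

/-! ### Estimates for a linear equation with a singular point -/

/-- One-sided barrier estimate for `P R' = w R - f` to the right of the zero `θ` of `P`: the
equation is strongly repelling, so going from `b` towards `θ` the solution forgets its value at `b`
at the rate `((x - θ) / (b - θ)) ^ q` as soon as `q P ≤ w (x - θ)`. -/
theorem le_of_singular_ode {P w f R R' : ℝ → ℝ} {θ b κ F C : ℝ} {q : ℕ} (hq : 1 ≤ q)
    (hκ : 0 < κ) (hC : 0 ≤ C) (hF : 0 ≤ F)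
    (hR : ∀ x ∈ Ioc θ b, HasDerivAt R (R' x) x)
    (hode : ∀ x ∈ Ioc θ b, P x * R' x = w x * R x - f x)
    (hP : ∀ x ∈ Ioc θ b, 0 < P x) (hqP : ∀ x ∈ Ioc θ b, q * P x ≤ w x * (x - θ))
    (hw : ∀ x ∈ Ioc θ b, κ ≤ w x) (hf : ∀ x ∈ Ioc θ b, f x ≤ F) (hRb : R b ≤ C)
    {x : ℝ} (hx : x ∈ Ioc θ b) : R x ≤ F / κ + C * ((x - θ) / (b - θ)) ^ q := by
  have hb : 0 < b - θ := by linarith [hx.1, hx.2]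
  by_contra! hlt
  obtain ⟨r, rfl⟩ : ∃ r, q = r + 1 := ⟨q - 1, by omega⟩
  set e : ℝ → ℝ := fun z => F / κ + C * ((z - θ) / (b - θ)) ^ (r + 1) - R z with he
  have hex : e x < 0 := by simp only [he]; linarith
  have hd : ∀ z ∈ Ioc θ b, HasDerivAt e
      (C * (((r + 1 : ℕ) : ℝ) * ((z - θ) / (b - θ)) ^ r * (1 / (b - θ))) - R' z) z := by
    intro z hz
    have h1 : HasDerivAt (fun z : ℝ => (z - θ) / (b - θ)) (1 / (b - θ)) z :=
      ((hasDerivAt_id z).sub_const θ).div_const _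
    have h2 := ((h1.pow (r + 1)).const_mul C).const_add (F / κ)
    have h3 := h2.sub (hR z hz)
    exact h3
  have hsub : ∀ z ∈ Icc x b, z ∈ Ioc θ b := fun z hz => ⟨hx.1.trans_le hz.1, hz.2⟩
  have key := image_le_of_deriv_right_lt_deriv_boundary (f := e) (a := x) (b := b)
    (fun z hz => (hd z (hsub z hz)).continuousAt.continuousWithinAt)
    (fun z hz => (hd z (hsub z ⟨hz.1, hz.2.le⟩)).hasDerivWithinAt)
    (B := fun _ => e x) (B' := fun _ => 0) le_rfl (fun z => hasDerivAt_const z (e x))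
    (by
      intro z hz hez
      have hz' := hsub z ⟨hz.1, hz.2.le⟩
      have hzθ : 0 < z - θ := by linarith [hz'.1]
      have hPz := hP z hz'
      have h1 := hqP z hz'
      have h2 := hw z hz'
      have h3 := hf z hz'
      have h4 := hode z hz'
      have hρ : 0 ≤ ((z - θ) / (b - θ)) ^ r := by positivity
      have h5 : P z * (C * (((r + 1 : ℕ) : ℝ) * ((z - θ) / (b - θ)) ^ r * (1 / (b - θ))))
          ≤ w z * (C * ((z - θ) / (b - θ)) ^ (r + 1)) := by
        have : P z * (C * (((r + 1 : ℕ) : ℝ) * ((z - θ) / (b - θ)) ^ r * (1 / (b - θ))))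
          = (((r + 1 : ℕ) : ℝ) * P z) * (C * ((z - θ) / (b - θ)) ^ r * (1 / (b - θ))) := by ring
        rw [this]
        have : w z * (C * ((z - θ) / (b - θ)) ^ (r + 1))
          = (w z * (z - θ)) * (C * ((z - θ) / (b - θ)) ^ r * (1 / (b - θ))) := by ring
        rw [this]
        exact mul_le_mul_of_nonneg_right h1 (by positivity)
      have h6 : F ≤ w z * (F / κ) := by
        have : F = κ * (F / κ) := by field_simp
        calc F = κ * (F / κ) := this
          _ ≤ _ := mul_le_mul_of_nonneg_right h2 (by positivity)
      have hez' : F / κ + C * ((z - θ) / (b - θ)) ^ (r + 1) - R z < 0 := by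
        have : e z < 0 := by rw [hez]; exact hex
        exact this
      have hwz : 0 < w z := hκ.trans_le h2
      have h7 : P z * (C * (((r + 1 : ℕ) : ℝ) * ((z - θ) / (b - θ)) ^ r * (1 / (b - θ)))
          - R' z) < 0 := by
        have := mul_neg_of_pos_of_neg hwz hez'
        rw [mul_sub, h4]
        nlinarith
      by_contra! h8
      have := mul_nonneg hPz.le h8
      linarith)
  have hb' := key (right_mem_Icc.2 hx.2)
  have : e b = F / κ + C - R b := by
    simp only [he]; rw [div_self hb.ne', one_pow, mul_one]
  have h0 : 0 ≤ F / κ := by positivity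
  linarith

/-- Two-sided version of `le_of_singular_ode`. -/
theorem abs_le_of_singular_ode {P w f R R' : ℝ → ℝ} {θ b κ F C : ℝ} {q : ℕ} (hq : 1 ≤ q)
    (hκ : 0 < κ)
    (hR : ∀ x ∈ Ioc θ b, HasDerivAt R (R' x) x)
    (hode : ∀ x ∈ Ioc θ b, P x * R' x = w x * R x - f x)
    (hP : ∀ x ∈ Ioc θ b, 0 < P x) (hqP : ∀ x ∈ Ioc θ b, q * P x ≤ w x * (x - θ))
    (hw : ∀ x ∈ Ioc θ b, κ ≤ w x) (hf : ∀ x ∈ Ioc θ b, |f x| ≤ F) (hRb : |R b| ≤ C)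
    {x : ℝ} (hx : x ∈ Ioc θ b) : |R x| ≤ F / κ + C * ((x - θ) / (b - θ)) ^ q := by
  have hC : 0 ≤ C := (abs_nonneg _).trans hRb
  have hF : 0 ≤ F := (abs_nonneg _).trans (hf x hx)
  refine abs_le'.2 ⟨?_, ?_⟩
  · exact le_of_singular_ode hq hκ hC hF hR hode hP hqP hw
      (fun z hz => (le_abs_self _).trans (hf z hz)) ((le_abs_self _).trans hRb) hx
  · refine le_of_singular_ode (f := fun z => -f z) (R := fun z => -R z) (R' := fun z => -R' z)
      hq hκ hC hF (fun z hz => (hR z hz).neg) (fun z hz => ?_) hP hqP hw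
      (fun z hz => (neg_le_abs _).trans (hf z hz)) ((neg_le_abs _).trans hRb) hx
    have := hode z hz
    linear_combination -this

/-- The coefficient of `T^{(k)}`, `k < n`, in the `n`-th derivative of `j V T - P T'`, in terms of
the derivatives `Pd`, `Vd` of `P` and `V`. -/
def leibnizCoeff (j : ℕ) (Pd Vd : ℕ → ℝ) (n k : ℕ) : ℝ :=
  j * (n.choose k * Vd (n - k)) - n.choose (n + 1 - k) * Pd (n + 1 - k)

theorem hasDerivAt_iteratedDeriv {f : ℝ → ℝ} {x : ℝ} (hf : ContDiffAt ℝ ∞ f x) (n : ℕ) :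
    HasDerivAt (iteratedDeriv n f) (iteratedDeriv (n + 1) f x) x := by
  rw [iteratedDeriv_succ]
  refine DifferentiableAt.hasDerivAt ?_
  have h := ContDiffWithinAt.differentiableWithinAt_iteratedDerivWithin (m := n)
    (contDiffWithinAt_univ.2 hf) (by exact_mod_cast ENat.natCast_lt_top n) (by simp)
  rwa [iteratedDerivWithin_univ, differentiableWithinAt_univ] at h

/-- The equation `P T' = j V T - g` differentiated `n` times. -/
theorem ode_iteratedDeriv {P V g T : ℝ → ℝ} {j : ℕ} {x : ℝ}
    (hP : ContDiffAt ℝ ∞ P x) (hV : ContDiffAt ℝ ∞ V x) (hg : ContDiffAt ℝ ∞ g x)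
    (hT : ContDiffAt ℝ ∞ T x) (hode : ∀ᶠ z in 𝓝 x, P z * deriv T z = j * V z * T z - g z) (n : ℕ) :
    P x * iteratedDeriv (n + 1) T x
      = (j * V x - n * deriv P x) * iteratedDeriv n T x
        - (iteratedDeriv n g x - ∑ k ∈ Finset.range n,
          leibnizCoeff j (fun i => iteratedDeriv i P x) (fun i => iteratedDeriv i V x) n k
            * iteratedDeriv k T x) := by
  have hn : ((n : ℕ∞) : WithTop ℕ∞) ≤ ∞ := by exact_mod_cast le_top
  have hT' : ContDiffAt ℝ ∞ (deriv T) x := by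
    have h1 : ContDiffAt ℝ ∞ (fderiv ℝ T) x := hT.fderiv_right (by simp)
    exact h1.clm_apply contDiffAt_const
  have e1 : iteratedDeriv n (fun z => deriv T z * P z) x
      = iteratedDeriv n (fun z => j * (T z * V z) - g z) x := by
    refine Filter.EventuallyEq.iteratedDeriv_eq n ?_
    filter_upwards [hode] with z hz
    linear_combination hz
  have e2 : iteratedDeriv n (fun z => j * (T z * V z) - g z) x
      = j * ∑ i ∈ Finset.range (n + 1), (n.choose i) * iteratedDeriv i T x
        * iteratedDeriv (n - i) V x - iteratedDeriv n g x := by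
    have h1 : ContDiffAt ℝ n (fun z => T z * V z) x := (hT.mul hV).of_le hn
    have := iteratedDeriv_sub (n := n) (f := fun z => (j : ℝ) * (T z * V z)) (g := g) (x := x)
      (contDiffAt_const.mul h1) (hg.of_le hn)
    rw [show (fun z => j * (T z * V z) - g z) = (fun z => (j : ℝ) * (T z * V z)) - g from rfl, this,
      iteratedDeriv_const_mul _ h1, iteratedDeriv_fun_mul (hT.of_le hn) (hV.of_le hn)]
  rw [iteratedDeriv_fun_mul (hT'.of_le hn) (hP.of_le hn), e2, Finset.sum_range_succ,
    Finset.sum_range_succ] at e1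
  simp only [← iteratedDeriv_succ', Nat.choose_self, Nat.cast_one, one_mul, Nat.sub_self,
    iteratedDeriv_zero] at e1
  have e3 : ∑ i ∈ Finset.range n, (n.choose i : ℝ) * iteratedDeriv (i + 1) T x
        * iteratedDeriv (n - i) P x = n * deriv P x * iteratedDeriv n T x
      + ∑ k ∈ Finset.range n, n.choose (n + 1 - k) * iteratedDeriv (n + 1 - k) P x
        * iteratedDeriv k T x := by
    cases n with
    | zero => simp
    | succ r =>
      rw [Finset.sum_range_succ, Finset.sum_range_succ' (n := r)]
      have : (r + 1).choose (r + 1 + 1 - 0) = 0 := Nat.choose_eq_zero_of_lt (by omega)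
      rw [this, show r + 1 - r = 1 by omega, iteratedDeriv_one, Nat.choose_succ_self_right]
      have : ∀ i ∈ Finset.range r, ((r + 1).choose i : ℝ) * iteratedDeriv (i + 1) T x
          * iteratedDeriv (r + 1 - i) P x
          = (r + 1).choose (r + 1 + 1 - (i + 1)) * iteratedDeriv (r + 1 + 1 - (i + 1)) P x
          * iteratedDeriv (i + 1) T x := by
        intro i hi
        have hi' := Finset.mem_range.1 hi
        rw [show r + 1 + 1 - (i + 1) = r + 1 - i by omega, Nat.choose_symm (by omega)]
        ring
      rw [Finset.sum_congr rfl this]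
      push_cast
      ring
  have e4 : ∑ k ∈ Finset.range n,
      leibnizCoeff j (fun i => iteratedDeriv i P x) (fun i => iteratedDeriv i V x) n k
            * iteratedDeriv k T x
      = j * ∑ i ∈ Finset.range n, (n.choose i) * iteratedDeriv i T x
        * iteratedDeriv (n - i) V x - ∑ k ∈ Finset.range n, n.choose (n + 1 - k)
          * iteratedDeriv (n + 1 - k) P x * iteratedDeriv k T x := by
    rw [Finset.mul_sum, ← Finset.sum_sub_distrib]
    refine Finset.sum_congr rfl fun k _ => ?_
    simp only [leibnizCoeff]
    ring
  rw [e4]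
  rw [e3] at e1
  linear_combination e1

theorem abs_leibnizCoeff_le {j n k : ℕ} (hj : 1 ≤ j) {Pd Vd : ℕ → ℝ} {M : ℝ}
    (hP : ∀ i ≤ n + 1, |Pd i| ≤ M) (hV : ∀ i ≤ n + 1, |Vd i| ≤ M) :
    |leibnizCoeff j Pd Vd n k| ≤ j * ((n.choose k + n.choose (n + 1 - k)) * M) := by
  have h1 := hV (n - k) (by omega)
  have h2 := hP (n + 1 - k) (by omega)
  have hM : 0 ≤ M := (abs_nonneg _).trans h1
  have hj' : (1 : ℝ) ≤ j := by exact_mod_cast hj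
  unfold leibnizCoeff
  refine (abs_sub _ _).trans ?_
  rw [abs_mul, abs_mul, abs_mul, Nat.abs_cast, Nat.abs_cast, Nat.abs_cast, add_mul, mul_add]
  refine add_le_add (by gcongr) ?_
  calc (n.choose (n + 1 - k) : ℝ) * |Pd (n + 1 - k)| ≤ 1 * (n.choose (n + 1 - k) * M) := by
        rw [one_mul]; gcongr
    _ ≤ _ := by gcongr

/-- The constant `∑_{k<n} (C(n,k) + C(n,n+1-k)) M` which dominates the lower order terms of the
differentiated equation. -/
def leibnizConst (M : ℝ) (n : ℕ) : ℝ :=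
  ∑ k ∈ Finset.range n, ((n.choose k + n.choose (n + 1 - k)) * M)

theorem leibnizConst_nonneg {M : ℝ} (hM : 0 ≤ M) (n : ℕ) : 0 ≤ leibnizConst M n :=
  Finset.sum_nonneg fun _ _ => by positivity

theorem abs_sum_leibnizCoeff_le {j n : ℕ} (hj : 1 ≤ j) {Pd Vd t : ℕ → ℝ} {M C : ℝ}
    (hP : ∀ i ≤ n + 1, |Pd i| ≤ M) (hV : ∀ i ≤ n + 1, |Vd i| ≤ M) (ht : ∀ k < n, |t k| ≤ C) :
    |∑ k ∈ Finset.range n, leibnizCoeff j Pd Vd n k * t k| ≤ j * (leibnizConst M n * C) := by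
  refine (Finset.abs_sum_le_sum_abs _ _).trans ?_
  rw [leibnizConst, Finset.sum_mul, Finset.mul_sum]
  refine Finset.sum_le_sum fun k hk => ?_
  rw [abs_mul, ← mul_assoc]
  have hM : 0 ≤ M := (abs_nonneg _).trans (hP 0 (by omega))
  exact mul_le_mul (abs_leibnizCoeff_le hj hP hV) (ht k (Finset.mem_range.1 hk)) (abs_nonneg _)
    (by positivity)

/-- The situation, to the right of the zero `θ` of `P`, in which the solutions `T` of
`P T' = j V T - g` are estimated. The constants `μ N v M B δ` are meant to be common to a family of
equations, in which `θ`, the functions and the integer `j ≥ 1` vary: `N` is the number of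
derivatives considered, `v` bounds `V` from below, `M` bounds the derivatives of the data on
`(θ, θ + δ]`, and the value of `T` at the right end `θ + δ` is allowed to grow geometrically in
`j`. -/
structure SingularODE (μ N : ℕ) (v M B δ θ : ℝ) (P V g T : ℝ → ℝ) (j : ℕ) : Prop where
  one_le : 1 ≤ j
  lt_one : θ + δ < 1
  contDiffAt_P : ∀ x ∈ Ioo θ 1, ContDiffAt ℝ ∞ P x
  contDiffAt_V : ∀ x ∈ Ioo θ 1, ContDiffAt ℝ ∞ V x
  contDiffAt_g : ∀ x ∈ Ioo θ 1, ContDiffAt ℝ ∞ g x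
  contDiffAt_T : ∀ x ∈ Ioo θ 1, ContDiffAt ℝ ∞ T x
  ode : ∀ x ∈ Ioo θ 1, P x * deriv T x = j * V x * T x - g x
  pow_le : ∀ x ∈ Ioc θ (θ + δ), (x - θ) ^ (μ + 1) ≤ P x
  le_mul : ∀ x ∈ Ioc θ (θ + δ), P x ≤ v / 2 * (x - θ)
  le_V : ∀ x ∈ Ioc θ (θ + δ), v ≤ V x
  deriv_le : ∀ x ∈ Ioc θ (θ + δ), ∀ n ≤ N, n * |deriv P x| ≤ v / 2
  bound_P : ∀ x ∈ Ioc θ (θ + δ), ∀ n ≤ N + 1, |iteratedDeriv n P x| ≤ M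
  bound_V : ∀ x ∈ Ioc θ (θ + δ), ∀ n ≤ N + 1, |iteratedDeriv n V x| ≤ M
  bound_g : ∀ x ∈ Ioc θ (θ + δ), ∀ n ≤ N + 1, |iteratedDeriv n g x| ≤ M
  bound_T : |T (θ + δ)| ≤ B ^ j

namespace SingularODE

variable {μ N : ℕ} {v M B δ θ : ℝ} {P V g T : ℝ → ℝ} {j : ℕ}

theorem one_le_cast (h : SingularODE μ N v M B δ θ P V g T j) : (1 : ℝ) ≤ j := by
  exact_mod_cast h.one_le

theorem mem_Ioo (h : SingularODE μ N v M B δ θ P V g T j) {x : ℝ} (hx : x ∈ Ioc θ (θ + δ)) :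
    x ∈ Ioo θ 1 := ⟨hx.1, hx.2.trans_lt h.lt_one⟩

theorem pos (h : SingularODE μ N v M B δ θ P V g T j) {x : ℝ} (hx : x ∈ Ioc θ (θ + δ)) :
    0 < P x := (pow_pos (sub_pos.2 hx.1) _).trans_le (h.pow_le x hx)

theorem ode_iter (h : SingularODE μ N v M B δ θ P V g T j) (n : ℕ) {x : ℝ} (hx : x ∈ Ioo θ 1) :
    P x * iteratedDeriv (n + 1) T x
      = (j * V x - n * deriv P x) * iteratedDeriv n T x
        - (iteratedDeriv n g x - ∑ k ∈ Finset.range n,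
          leibnizCoeff j (fun i => iteratedDeriv i P x) (fun i => iteratedDeriv i V x) n k
            * iteratedDeriv k T x) :=
  ode_iteratedDeriv (h.contDiffAt_P x hx) (h.contDiffAt_V x hx) (h.contDiffAt_g x hx)
    (h.contDiffAt_T x hx) (eventually_of_mem (isOpen_Ioo.mem_nhds hx) h.ode) n

theorem hasDerivAt (h : SingularODE μ N v M B δ θ P V g T j) (n : ℕ) {x : ℝ} (hx : x ∈ Ioo θ 1) :
    HasDerivAt (iteratedDeriv n T) (iteratedDeriv (n + 1) T x) x :=
  hasDerivAt_iteratedDeriv (h.contDiffAt_T x hx) n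

/-- The weight of the `n`-th differentiated equation. -/
theorem le_weight (h : SingularODE μ N v M B δ θ P V g T j) (hv : 0 < v) {n : ℕ} (hn : n ≤ N)
    {x : ℝ} (hx : x ∈ Ioc θ (θ + δ)) : j * (v / 2) ≤ j * V x - n * deriv P x := by
  have h1 := h.deriv_le x hx n hn
  have h2 := h.le_V x hx
  have h3 := h.one_le_cast
  have h4 : n * deriv P x ≤ n * |deriv P x| := by gcongr; exact le_abs_self _
  nlinarith

theorem abs_rhs_le (h : SingularODE μ N v M B δ θ P V g T j) {n : ℕ} (hn : n ≤ N) {x C : ℝ}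
    (hx : x ∈ Ioc θ (θ + δ)) (hC : ∀ k < n, |iteratedDeriv k T x| ≤ C) :
    |iteratedDeriv n g x - ∑ k ∈ Finset.range n,
      leibnizCoeff j (fun i => iteratedDeriv i P x) (fun i => iteratedDeriv i V x) n k
        * iteratedDeriv k T x| ≤ j * (M + leibnizConst M n * C) := by
  refine (abs_sub _ _).trans ?_
  have h1 := h.bound_g x hx n (by omega)
  have hM : 0 ≤ M := (abs_nonneg _).trans h1
  have h2 := abs_sum_leibnizCoeff_le (n := n) h.one_le
    (Pd := fun i => iteratedDeriv i P x) (Vd := fun i => iteratedDeriv i V x)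
    (t := fun k => iteratedDeriv k T x) (M := M) (C := C)
    (fun i hi => h.bound_P x hx i (by omega)) (fun i hi => h.bound_V x hx i (by omega)) hC
  rw [mul_add]
  refine add_le_add (h1.trans ?_) h2
  nlinarith [h.one_le_cast]

/-- The derivatives of the solution are bounded near `θ` by constants which do not depend on the
equation. The interval shrinks at each step, so that the growth in `j` of the value of the next
derivative at its right end is compensated by the factor `2⁻ʲ` of the barrier. -/
theorem exists_bound (μ N : ℕ) {v M B δ : ℝ} (hv : 0 < v) (hM : 0 ≤ M) (hB : 1 ≤ B) (hδ : 0 < δ)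
    (n : ℕ) (hn : n ≤ N) : ∃ C ≥ 0, ∃ δ' > 0, δ' ≤ δ ∧
      ∀ {θ : ℝ} {P V g T : ℝ → ℝ} {j : ℕ}, SingularODE μ N v M B δ θ P V g T j →
        ∀ k ≤ n, ∀ x ∈ Ioc θ (θ + δ'), |iteratedDeriv k T x| ≤ C := by
  induction n with
  | zero =>
    refine ⟨M / (v / 2) + 1, by positivity, δ / B, by positivity, div_le_self hδ.le hB, ?_⟩
    intro θ P V g T j h k hk x hx
    obtain rfl : k = 0 := by omega
    have hx' : x ∈ Ioc θ (θ + δ) := ⟨hx.1, hx.2.trans (by gcongr; exact div_le_self hδ.le hB)⟩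
    have hj := h.one_le_cast
    have h1 := abs_le_of_singular_ode (q := j) (κ := j * (v / 2)) (F := j * M) (C := B ^ j) (b := θ + δ)
      (θ := θ) (P := P) (w := fun x => j * V x) (f := g) (R := T) (R' := deriv T) h.one_le
      (by positivity)
      (fun z hz => by simpa using h.hasDerivAt 0 (h.mem_Ioo hz)) (fun z hz => h.ode z (h.mem_Ioo hz))
      (fun z hz => h.pos hz)
      (fun z hz => by
        have h2 := h.le_mul z hz
        have h3 := h.le_V z hz
        have h4 : 0 < z - θ := sub_pos.2 hz.1
        have : P z ≤ V z * (z - θ) := h2.trans (by gcongr; linarith)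
        nlinarith)
      (fun z hz => by have := h.le_V z hz; gcongr; linarith)
      (fun z hz => by
        have := h.bound_g z hz 0 (by omega)
        rw [iteratedDeriv_zero] at this
        nlinarith) h.bound_T hx'
    rw [iteratedDeriv_zero]
    refine h1.trans (add_le_add ?_ ?_)
    · rw [mul_div_mul_left _ _ (by positivity)]
    · rw [← mul_pow]
      refine pow_le_one₀ ?_ ?_
      · have : 0 < x - θ := sub_pos.2 hx.1
        have : θ + δ - θ = δ := by ring
        rw [this]; positivity
      · have h5 : x - θ ≤ δ / B := by linarith [hx.2]
        have : θ + δ - θ = δ := by ring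
        rw [this]
        calc B * ((x - θ) / δ) ≤ B * (δ / B / δ) := by gcongr
          _ = 1 := by field_simp
  | succ n ih =>
    obtain ⟨C, hC0, d, hd0, hdδ, hC⟩ := ih (by omega)
    set F : ℝ := M + leibnizConst M (n + 1) * C with hF
    set D : ℝ := ((M + n * M) * C + (M + leibnizConst M n * C)) / d ^ (μ + 1) with hD
    have hL1 := leibnizConst_nonneg hM (n + 1)
    have hL2 := leibnizConst_nonneg hM n
    have hF0 : 0 ≤ F := by positivity
    have hD0 : 0 ≤ D := by positivity
    refine ⟨C + (F / (v / 2) + D), by positivity, d / 2, by positivity, by linarith, ?_⟩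
    intro θ P V g T j h k hk x hx
    have hsub : ∀ {z}, z ∈ Ioc θ (θ + d) → z ∈ Ioc θ (θ + δ) :=
      fun hz => ⟨hz.1, hz.2.trans (by linarith)⟩
    have hxd : x ∈ Ioc θ (θ + d) := ⟨hx.1, hx.2.trans (by linarith)⟩
    rcases Nat.lt_or_ge k (n + 1) with hk' | hk'
    · exact (hC h k (by omega) x hxd).trans (by linarith [show 0 ≤ F / (v / 2) + D by positivity])
    obtain rfl : k = n + 1 := by omega
    have hj := h.one_le_cast
    have hb : θ + d ∈ Ioc θ (θ + d) := ⟨by linarith, le_rfl⟩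
    have hRb : |iteratedDeriv (n + 1) T (θ + d)| ≤ j * D := by
      have e := h.ode_iter n (h.mem_Ioo (hsub hb))
      have hPb : d ^ (μ + 1) ≤ P (θ + d) := by
        have := h.pow_le _ (hsub hb); rwa [add_sub_cancel_left] at this
      have h1 := h.abs_rhs_le (n := n) (by omega) (hsub hb) (C := C)
        (fun k hk => hC h k (by omega) _ hb)
      have h2 := hC h n le_rfl _ hb
      have h3 : |j * V (θ + d) - n * deriv P (θ + d)| ≤ j * (M + n * M) := by
        have h4 := h.bound_V _ (hsub hb) 0 (by omega)
        have h5 := h.bound_P _ (hsub hb) 1 (by omega)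
        rw [iteratedDeriv_zero] at h4
        rw [iteratedDeriv_one] at h5
        refine (abs_sub _ _).trans ?_
        rw [abs_mul, abs_mul, Nat.abs_cast, Nat.abs_cast, mul_add]
        refine add_le_add (by gcongr) ?_
        calc (n : ℝ) * |deriv P (θ + d)| ≤ 1 * (n * M) := by rw [one_mul]; gcongr
          _ ≤ _ := by gcongr
      have h6 : |P (θ + d) * iteratedDeriv (n + 1) T (θ + d)|
          ≤ j * ((M + n * M) * C + (M + leibnizConst M n * C)) := by
        rw [e]
        refine (abs_sub _ _).trans ?_
        rw [abs_mul, mul_add, ← mul_assoc (j : ℝ)]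
        exact add_le_add (mul_le_mul h3 h2 (abs_nonneg _) (by positivity)) h1
      rw [abs_mul, abs_of_pos (h.pos (hsub hb))] at h6
      rw [hD, ← mul_div_assoc, le_div_iff₀ (by positivity), mul_comm]
      exact (mul_le_mul_of_nonneg_right hPb (abs_nonneg _)).trans h6
    have h1 := abs_le_of_singular_ode (q := j) (κ := j * (v / 2)) (F := j * F) (C := j * D)
      (b := θ + d) (θ := θ) (P := P) (w := fun x => j * V x - (n + 1 : ℕ) * deriv P x)
      (f := fun x => iteratedDeriv (n + 1) g x - ∑ k ∈ Finset.range (n + 1),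
          leibnizCoeff j (fun i => iteratedDeriv i P x) (fun i => iteratedDeriv i V x) (n + 1) k
            * iteratedDeriv k T x)
      (R := iteratedDeriv (n + 1) T) (R' := iteratedDeriv (n + 1 + 1) T) h.one_le
      (by positivity) (fun z hz => h.hasDerivAt _ (h.mem_Ioo (hsub hz)))
      (fun z hz => h.ode_iter (n + 1) (h.mem_Ioo (hsub hz)))
      (fun z hz => h.pos (hsub hz))
      (fun z hz => by
        have h2 := h.le_mul z (hsub hz)
        have h3 := h.le_weight hv hn (hsub hz)
        have h4 : 0 < z - θ := sub_pos.2 hz.1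
        calc (j : ℝ) * P z ≤ j * (v / 2 * (z - θ)) := by gcongr
          _ = j * (v / 2) * (z - θ) := by ring
          _ ≤ _ := by gcongr)
      (fun z hz => h.le_weight hv hn (hsub hz))
      (fun z hz => h.abs_rhs_le hn (hsub hz) fun k hk => hC h k (by omega) z hz)
      hRb hxd
    refine h1.trans ?_
    have h2 : (j : ℝ) * D * ((x - θ) / (θ + d - θ)) ^ j ≤ D := by
      have h3 : 0 < x - θ := sub_pos.2 hx.1
      rw [show θ + d - θ = d by ring]
      have h4 : (x - θ) / d ≤ 1 / 2 := by
        rw [div_le_iff₀ hd0]; linarith [hx.2]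
      have h5 : ((x - θ) / d) ^ j ≤ (1 / 2) ^ j := pow_le_pow_left₀ (by positivity) h4 j
      have h6 : (j : ℝ) ≤ 2 ^ j := by exact_mod_cast Nat.lt_two_pow_self.le
      calc (j : ℝ) * D * ((x - θ) / d) ^ j ≤ 2 ^ j * D * (1 / 2) ^ j := by gcongr
        _ = D * (2 * (1 / 2)) ^ j := by rw [mul_pow]; ring
        _ = D := by norm_num
    rw [mul_div_mul_left _ _ (by positivity)]
    linarith

end SingularODE

/-! ### The formal solution at the singular point -/

/-- The derivatives at the zero of `P` of the solution of `P T' = j V T - g`, computed formally from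
the derivatives `Pd`, `Vd`, `gd` of `P`, `V`, `g` there. (It is a junk value if one of the
denominators vanishes, i.e. at a resonance.) -/
noncomputable def formalDeriv (j : ℕ) (Pd Vd gd : ℕ → ℝ) (n : ℕ) : ℝ :=
  (gd n - ∑ k : Fin n, leibnizCoeff j Pd Vd n k * formalDeriv j Pd Vd gd k)
    / (j * Vd 0 - n * Pd 1)

theorem formalDeriv_eq (j : ℕ) (Pd Vd gd : ℕ → ℝ) (n : ℕ) :
    formalDeriv j Pd Vd gd n
      = (gd n - ∑ k ∈ Finset.range n, leibnizCoeff j Pd Vd n k * formalDeriv j Pd Vd gd k)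
        / (j * Vd 0 - n * Pd 1) := by
  rw [formalDeriv, Finset.sum_range (fun k => leibnizCoeff j Pd Vd n k * formalDeriv j Pd Vd gd k)]

theorem formalDeriv_eq_zero {j : ℕ} {Pd Vd gd : ℕ → ℝ} {m : ℕ} (hg : ∀ k < m, gd k = 0)
    {n : ℕ} (hn : n < m) : formalDeriv j Pd Vd gd n = 0 := by
  induction n using Nat.strong_induction_on with
  | _ n ih =>
    rw [formalDeriv_eq, hg n hn, Finset.sum_eq_zero, sub_zero, zero_div]
    intro k hk
    have hk' := Finset.mem_range.1 hk
    rw [ih k hk' (hk'.trans hn), mul_zero]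

/-- The formal derivatives are bounded by the derivatives of `g`, and they gain a factor `1 / j`. -/
theorem exists_abs_formalDeriv_le {v M : ℝ} (hv : 0 < v) (hM : 0 ≤ M) (n : ℕ) :
    ∃ C ≥ 0, ∀ {j : ℕ} {Pd Vd gd : ℕ → ℝ} {G : ℝ}, 1 ≤ j → (∀ i ≤ n + 1, |Pd i| ≤ M) →
      (∀ i ≤ n + 1, |Vd i| ≤ M) → (∀ i ≤ n, |gd i| ≤ G) →
      (∀ i ≤ n, j * v ≤ j * Vd 0 - i * Pd 1) →
      ∀ i ≤ n, |formalDeriv j Pd Vd gd i| ≤ C * (G / j) := by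
  induction n with
  | zero =>
    refine ⟨1 / v, by positivity, ?_⟩
    intro j Pd Vd gd G hj hP hV hg hd i hi
    obtain rfl : i = 0 := by omega
    have hj' : (0 : ℝ) < j := by exact_mod_cast hj
    have h1 := hd 0 le_rfl
    have h2 : 0 < j * Vd 0 - (0 : ℕ) * Pd 1 := lt_of_lt_of_le (by positivity) h1
    rw [formalDeriv_eq, Finset.range_zero, Finset.sum_empty, sub_zero, abs_div, abs_of_pos h2,
      div_mul_div_comm, one_mul, mul_comm v]
    have hG : 0 ≤ G := (abs_nonneg _).trans (hg 0 le_rfl)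
    exact div_le_div₀ hG (hg 0 le_rfl) (by positivity) h1
  | succ n ih =>
    obtain ⟨C, hC0, hC⟩ := ih
    have hL := leibnizConst_nonneg hM (n + 1)
    refine ⟨C + (1 + leibnizConst M (n + 1) * C) / v, by positivity, ?_⟩
    intro j Pd Vd gd G hj hP hV hg hd i hi
    have hG : 0 ≤ G := (abs_nonneg _).trans (hg 0 (by omega))
    have hj' : (1 : ℝ) ≤ j := by exact_mod_cast hj
    have ih' := hC hj (fun i hi => hP i (by omega)) (fun i hi => hV i (by omega))
      (fun i hi => hg i (by omega)) (fun i hi => hd i (by omega))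
    rcases Nat.lt_or_ge i (n + 1) with hi' | hi'
    · refine (ih' i (by omega)).trans ?_
      gcongr
      have : 0 ≤ (1 + leibnizConst M (n + 1) * C) / v := by positivity
      linarith
    obtain rfl : i = n + 1 := by omega
    have h1 := hd (n + 1) le_rfl
    have h2 : 0 < j * Vd 0 - (n + 1 : ℕ) * Pd 1 := lt_of_lt_of_le (by positivity) h1
    have h3 := abs_sum_leibnizCoeff_le (n := n + 1) hj (t := formalDeriv j Pd Vd gd)
      (M := M) (C := C * (G / j)) hP hV (fun k hk => ih' k (by omega))
    rw [formalDeriv_eq, abs_div, abs_of_pos h2]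
    have h4 : |gd (n + 1) - ∑ k ∈ Finset.range (n + 1), leibnizCoeff j Pd Vd (n + 1) k
        * formalDeriv j Pd Vd gd k| ≤ G + leibnizConst M (n + 1) * C * G := by
      refine (abs_sub _ _).trans (add_le_add (hg _ le_rfl) (h3.trans_eq ?_))
      field_simp
    calc _ ≤ (G + leibnizConst M (n + 1) * C * G) / (j * v) :=
          div_le_div₀ (by positivity) h4 (by positivity) h1
      _ = (1 + leibnizConst M (n + 1) * C) / v * (G / j) := by field_simp
      _ ≤ _ := by gcongr; linarith

theorem continuousOn_formalDeriv {X : Type*} [TopologicalSpace X] {S : Set X} {j : ℕ}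
    {Pd Vd gd : X → ℕ → ℝ} (hP : ∀ i, ContinuousOn (fun p => Pd p i) S)
    (hV : ∀ i, ContinuousOn (fun p => Vd p i) S) (hg : ∀ i, ContinuousOn (fun p => gd p i) S)
    {n : ℕ} (hd : ∀ p ∈ S, ∀ i ≤ n, (j * Vd p 0 - i * Pd p 1 : ℝ) ≠ 0) :
    ContinuousOn (fun p => formalDeriv j (Pd p) (Vd p) (gd p) n) S := by
  induction n using Nat.strong_induction_on with
  | _ n ih =>
    simp only [fun p => formalDeriv_eq j (Pd p) (Vd p) (gd p) n]
    refine ContinuousOn.div (ContinuousOn.sub (hg n) (continuousOn_finsetSum _ fun k hk => ?_))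
      ((continuousOn_const.mul (hV 0)).sub (continuousOn_const.mul (hP 1)))
      (fun p hp => hd p hp n le_rfl)
    have hk' := Finset.mem_range.1 hk
    refine ContinuousOn.mul ?_ (ih k hk' fun p hp i hi => hd p hp i (by omega))
    unfold leibnizCoeff
    exact (continuousOn_const.mul (continuousOn_const.mul (hV _))).sub
      (continuousOn_const.mul (hP _))

/-- If the derivatives of the solution are bounded near `θ`, then they tend to the formal ones:
the term `P T⁽ⁿ⁺¹⁾` of the differentiated equation disappears in the limit. -/
theorem SingularODE.tendsto_iteratedDeriv {μ N : ℕ} {v M B δ θ : ℝ} {P V g T : ℝ → ℝ} {j : ℕ}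
    (h : SingularODE μ N v M B δ θ P V g T j) {δ' C : ℝ} (hδ' : 0 < δ') (hδ : δ' ≤ δ) (hv : 0 < v)
    (hP : ContDiffAt ℝ ∞ P θ) (hV : ContDiffAt ℝ ∞ V θ) (hg : ContDiffAt ℝ ∞ g θ) (hPθ : P θ = 0)
    {n : ℕ} (hn : n < N) (hC : ∀ k ≤ N, ∀ x ∈ Ioc θ (θ + δ'), |iteratedDeriv k T x| ≤ C) :
    Tendsto (iteratedDeriv n T) (𝓝[>] θ) (𝓝 (formalDeriv j (fun i => iteratedDeriv i P θ)
      (fun i => iteratedDeriv i V θ) (fun i => iteratedDeriv i g θ) n)) := by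
  have hIoc : Ioc θ (θ + δ') ∈ 𝓝[>] θ := Ioc_mem_nhdsGT (by linarith)
  have lim : ∀ {f : ℝ → ℝ}, ContDiffAt ℝ ∞ f θ → ∀ i,
      Tendsto (iteratedDeriv i f) (𝓝[>] θ) (𝓝 (iteratedDeriv i f θ)) := fun hf i =>
    (hasDerivAt_iteratedDeriv hf i).continuousAt.tendsto.mono_left nhdsWithin_le_nhds
  induction n using Nat.strong_induction_on with
  | _ n ih =>
    have hw : Tendsto (fun x => j * V x - n * deriv P x) (𝓝[>] θ)
        (𝓝 (j * iteratedDeriv 0 V θ - n * iteratedDeriv 1 P θ)) := by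
      have h1 := lim hV 0
      have h2 := lim hP 1
      rw [iteratedDeriv_zero] at h1 ⊢
      rw [iteratedDeriv_one] at h2 ⊢
      exact (h1.const_mul _).sub (h2.const_mul _)
    have hw0 : (j * iteratedDeriv 0 V θ - n * iteratedDeriv 1 P θ : ℝ) ≠ 0 := by
      have h1 : j * (v / 2) ≤ j * iteratedDeriv 0 V θ - n * iteratedDeriv 1 P θ :=
        ge_of_tendsto hw (mem_of_superset hIoc fun x hx =>
          h.le_weight hv hn.le ⟨hx.1, hx.2.trans (by linarith)⟩)
      have := h.one_le_cast
      exact (lt_of_lt_of_le (by positivity) h1).ne'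
    have hPT : Tendsto (fun x => P x * iteratedDeriv (n + 1) T x) (𝓝[>] θ) (𝓝 0) := by
      have h1 : Tendsto P (𝓝[>] θ) (𝓝 0) := by
        have := lim hP 0
        rwa [iteratedDeriv_zero, hPθ] at this
      refine h1.zero_mul_isBoundedUnder_le ⟨C, ?_⟩
      simp only [eventually_map]
      filter_upwards [hIoc] with x hx
      exact hC (n + 1) hn x hx
    have hsum := tendsto_finsetSum (f := fun k x =>
        leibnizCoeff j (fun i => iteratedDeriv i P x) (fun i => iteratedDeriv i V x) n k
          * iteratedDeriv k T x) (Finset.range n) (x := 𝓝[>] θ)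
        (a := fun k => leibnizCoeff j (fun i => iteratedDeriv i P θ)
          (fun i => iteratedDeriv i V θ) n k * formalDeriv j (fun i => iteratedDeriv i P θ)
          (fun i => iteratedDeriv i V θ) (fun i => iteratedDeriv i g θ) k) (fun k hk => by
        have hk' := Finset.mem_range.1 hk
        refine Tendsto.mul ?_ (ih k hk' (by omega))
        exact (((lim hV _).const_mul _).const_mul _).sub ((lim hP _).const_mul _))
    rw [formalDeriv_eq]
    have hlim := (hPT.add ((lim hg n).sub hsum)).div hw hw0
    rw [zero_add] at hlim
    refine hlim.congr' ?_
    filter_upwards [hIoc] with x hx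
    have hx' : x ∈ Ioc θ (θ + δ) := ⟨hx.1, hx.2.trans (by linarith)⟩
    have h1 := h.le_weight hv hn.le hx'
    have := h.one_le_cast
    have h2 : 0 < j * V x - n * deriv P x := lt_of_lt_of_le (by positivity) h1
    simp only [Pi.div_apply]
    rw [div_eq_iff h2.ne', h.ode_iter n (h.mem_Ioo hx')]
    ring

/-! ### Sums of families with coefficients bounded in `ℓ¹` -/

/-- If the coefficients `u i` are only bounded in `ℓ¹`, uniformly in the parameter, a series
`∑ u i * w i` with `w i → 0` uniformly is still uniformly convergent. -/
theorem continuousOn_tsum_mul {ι X : Type*} [TopologicalSpace X] {S : Set X} {u w : ι → X → ℝ}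
    {M : ℝ} {bd : ι → ℝ} (hu : ∀ i, ContinuousOn (u i) S) (hw : ∀ i, ContinuousOn (w i) S)
    (hsum : ∀ x ∈ S, Summable fun i => |u i x|) (hM : ∀ x ∈ S, ∑' i, |u i x| ≤ M)
    (hb : Tendsto bd cofinite (𝓝 0)) (hwb : ∀ i, ∀ x ∈ S, |w i x| ≤ bd i) :
    ContinuousOn (fun x => ∑' i, u i x * w i x) S := by
  rcases S.eq_empty_or_nonempty with rfl | ⟨x₀, hx₀⟩
  · exact continuousOn_empty _
  have hM0 : 0 ≤ M := (tsum_nonneg fun i => abs_nonneg (u i x₀)).trans (hM x₀ hx₀)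
  have key : TendstoUniformlyOn (fun (s : Finset ι) x => ∑ i ∈ s, u i x * w i x)
      (fun x => ∑' i, u i x * w i x) atTop S := by
    rw [Metric.tendstoUniformlyOn_iff]
    intro η hη
    have hη' : 0 < η / (M + 1) := by positivity
    have hfin : {i | ¬ bd i < η / (M + 1)}.Finite := (hb.eventually (gt_mem_nhds hη'))
    filter_upwards [eventually_ge_atTop hfin.toFinset] with s hs x hx
    have hsmall : ∀ i : {i // i ∉ s}, |w i x| ≤ η / (M + 1) := by
      intro i
      have : ¬ ¬ bd i < η / (M + 1) := fun hc => i.2 (hs (hfin.mem_toFinset.2 hc))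
      exact (hwb i x hx).trans (not_not.1 this).le
    -- the family is bounded by a multiple of `|u i x|`
    obtain ⟨W, hW⟩ : ∃ W, ∀ i, |w i x| ≤ W := by
      obtain ⟨W, hW⟩ := ((hfin.image fun i => |w i x|).bddAbove)
      refine ⟨max W (η / (M + 1)), fun i => ?_⟩
      by_cases hi : bd i < η / (M + 1)
      · exact ((hwb i x hx).trans hi.le).trans (le_max_right _ _)
      · exact (hW ⟨i, hi, rfl⟩).trans (le_max_left _ _)
    have hs1 : Summable fun i => u i x * w i x := by
      refine Summable.of_norm_bounded ((hsum x hx).mul_right W) fun i => ?_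
      rw [Real.norm_eq_abs, abs_mul]
      exact mul_le_mul_of_nonneg_left (hW i) (abs_nonneg _)
    have hs2 : Summable fun i : {i // i ∉ s} => |u i x| * (η / (M + 1)) :=
      ((hsum x hx).subtype _).mul_right _
    rw [Real.dist_eq, ← hs1.sum_add_tsum_subtype_compl s, add_sub_cancel_left]
    calc |∑' i : {i // i ∉ s}, u i x * w i x|
        ≤ ∑' i : {i // i ∉ s}, |u i x| * (η / (M + 1)) := by
          rw [← Real.norm_eq_abs]
          refine tsum_of_norm_bounded hs2.hasSum fun i => ?_
          rw [Real.norm_eq_abs, abs_mul]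
          exact mul_le_mul_of_nonneg_left (hsmall i) (abs_nonneg _)
      _ = (∑' i : {i // i ∉ s}, |u i x|) * (η / (M + 1)) := tsum_mul_right
      _ ≤ M * (η / (M + 1)) := by
          refine mul_le_mul_of_nonneg_right (le_trans ?_ (hM x hx)) hη'.le
          exact Summable.tsum_subtype_le (fun i => |u i x|) {i | i ∉ s} (fun i => abs_nonneg _) (hsum x hx)
      _ < η := by
          rw [mul_div_assoc', div_lt_iff₀ (by positivity)]; nlinarith
  refine key.continuousOn (Frequently.of_forall fun s => ?_)
  exact continuousOn_finsetSum _ fun i _ => (hu i).mul (hw i)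

/-! ### Derivatives in one of the variables of an analytic function -/

theorem analyticAt_iteratedDeriv_fst {E : Type*} [NormedAddCommGroup E] [NormedSpace ℝ E]
    {f : ℝ × E → ℝ} {p : ℝ × E} (hf : AnalyticAt ℝ f p) (n : ℕ) :
    AnalyticAt ℝ (fun q : ℝ × E => iteratedDeriv n (fun x => f (x, q.2)) q.1) p := by
  induction n with
  | zero => simpa using hf
  | succ n ih =>
    have h1 : AnalyticAt ℝ (fun q => fderiv ℝ
        (fun q : ℝ × E => iteratedDeriv n (fun x => f (x, q.2)) q.1) q ((1 : ℝ), (0 : E))) p :=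
      (ContinuousLinearMap.apply ℝ ℝ ((1 : ℝ), (0 : E))).analyticAt _ |>.comp ih.fderiv
    refine h1.congr ?_
    filter_upwards [ih.eventually_analyticAt] with q hq
    rw [iteratedDeriv_succ]
    have h2 := hq.differentiableAt.hasFDerivAt
    have h3 : HasDerivAt (fun x : ℝ => (x, q.2)) ((1 : ℝ), (0 : E)) q.1 :=
      (hasDerivAt_id q.1).prodMk (hasDerivAt_const _ _)
    exact (h2.comp_hasDerivAt q.1 h3).deriv.symm

/-! ### Taylor remainders and the operator `s ∂_s` -/

/-- The `n`-th derivative of the Taylor polynomial of degree `l` at `0` with derivatives `d`. -/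
noncomputable def taylorDeriv (l : ℕ) (d : ℕ → ℝ) (n : ℕ) (s : ℝ) : ℝ :=
  ∑ i ∈ Finset.range (l + 1 - n), d (n + i) * (s ^ i / i.factorial)

theorem hasDerivAt_taylorDeriv (l : ℕ) (d : ℕ → ℝ) (n : ℕ) (s : ℝ) :
    HasDerivAt (taylorDeriv l d n) (taylorDeriv l d (n + 1) s) s := by
  rcases Nat.lt_or_ge l n with hn | hn
  · have h1 : taylorDeriv l d n = fun _ => 0 := by
      ext s; simp [taylorDeriv, show l + 1 - n = 0 by omega]
    have h2 : taylorDeriv l d (n + 1) s = 0 := by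
      simp [taylorDeriv, show l - n = 0 by omega]
    rw [h1, h2]; exact hasDerivAt_const _ _
  · have h1 : taylorDeriv l d n = fun s => ∑ i ∈ Finset.range (l - n),
        d (n + (i + 1)) * (s ^ (i + 1) / (i + 1).factorial) + d n := by
      ext s
      rw [taylorDeriv, show l + 1 - n = l - n + 1 by omega, Finset.sum_range_succ']
      simp
    rw [h1, taylorDeriv, show l + 1 - (n + 1) = l - n by omega]
    refine HasDerivAt.add_const _ (HasDerivAt.fun_sum fun i _ => ?_)
    have h2 := ((hasDerivAt_pow (i + 1) s).div_const ((i + 1).factorial : ℝ)).const_mul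
      (d (n + (i + 1)))
    refine h2.congr_deriv ?_
    rw [Nat.factorial_succ, add_assoc, add_comm 1 i]
    have : (i.factorial : ℝ) ≠ 0 := by positivity
    push_cast
    field_simp

theorem taylorDeriv_of_lt {l n : ℕ} (hn : l < n) (d : ℕ → ℝ) (s : ℝ) :
    taylorDeriv l d n s = 0 := by
  simp [taylorDeriv, show l + 1 - n = 0 by omega]

theorem taylorDeriv_at_zero {l n : ℕ} (hn : n ≤ l) (d : ℕ → ℝ) : taylorDeriv l d n 0 = d n := by
  rw [taylorDeriv, show l + 1 - n = l - n + 1 by omega, Finset.sum_range_succ']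
  simp

/-- Functions `R n` on `(0, b)`, each the derivative of the preceding one, the first ones being
flat at `0`: bounds for `R (l + 1)` integrate to bounds for the preceding functions. -/
theorem abs_le_mul_pow_of_tower {R : ℕ → ℝ → ℝ} {b C : ℝ} {l : ℕ}
    (hR : ∀ n ≤ l, ∀ s ∈ Ioo 0 b, HasDerivAt (R n) (R (n + 1) s) s)
    (hlim : ∀ n ≤ l, Tendsto (R n) (𝓝[>] 0) (𝓝 0)) (hC : ∀ s ∈ Ioo 0 b, |R (l + 1) s| ≤ C)
    {i : ℕ} (hi : i ≤ l + 1) {s : ℝ} (hs : s ∈ Ioo 0 b) : |R (l + 1 - i) s| ≤ C * s ^ i := by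
  induction i generalizing s with
  | zero => simpa using hC s hs
  | succ i ih =>
    have hn : l + 1 - (i + 1) + 1 = l + 1 - i := by omega
    set n := l + 1 - (i + 1) with hndef
    have hC0 : 0 ≤ C := (abs_nonneg _).trans (hC s hs)
    have hmv : ∀ r ∈ Ioo 0 s, |R n s - R n r| ≤ C * s ^ i * s := by
      intro r hr
      have hsub : Icc r s ⊆ Ioo 0 b := fun z hz => ⟨hr.1.trans_le hz.1, hz.2.trans_lt hs.2⟩
      have := Convex.norm_image_sub_le_of_norm_hasDerivWithin_le (f := R n) (f' := R (n + 1))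
        (s := Icc r s) (C := C * s ^ i) (x := r) (y := s)
        (fun z hz => (hR n (by omega) z (hsub hz)).hasDerivWithinAt)
        (fun z hz => by
          rw [hn, Real.norm_eq_abs]
          refine (ih (by omega) (hsub hz)).trans ?_
          have : 0 ≤ z := (hsub hz).1.le
          gcongr
          exact hz.2)
        (convex_Icc _ _) (left_mem_Icc.2 hr.2.le) (right_mem_Icc.2 hr.2.le)
      rw [Real.norm_eq_abs, Real.norm_eq_abs, abs_of_pos (sub_pos.2 hr.2)] at this
      refine this.trans ?_
      have : 0 ≤ C * s ^ i := mul_nonneg hC0 (pow_nonneg hs.1.le _)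
      gcongr
      linarith [hr.1]
    have h1 : Tendsto (fun r => |R n s - R n r|) (𝓝[>] 0) (𝓝 |R n s - 0|) :=
      ((hlim n (by omega)).const_sub _).abs
    rw [sub_zero] at h1
    have := le_of_tendsto h1 (mem_of_superset (Ioo_mem_nhdsGT hs.1) hmv)
    rwa [mul_assoc, ← pow_succ] at this

theorem eulerOp_iterate_congr {f g : ℝ → ℝ} {S : Set ℝ} (hS : IsOpen S) (hfg : EqOn f g S)
    (r : ℕ) : EqOn (eulerOp^[r] f) (eulerOp^[r] g) S := by
  induction r with
  | zero => exact hfg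
  | succ r ih =>
    intro s hs
    simp only [Function.iterate_succ_apply', eulerOp]
    rw [Filter.EventuallyEq.deriv_eq (eventually_of_mem (hS.mem_nhds hs) ih)]

/-- The coefficients of `(s ∂_s) ^ r (R / s ^ l) = ∑ₙ eulerCoeff l r n * s ^ (n - l) * R⁽ⁿ⁾`. -/
def eulerCoeff (l : ℕ) : ℕ → ℕ → ℝ
  | 0, 0 => 1
  | 0, _ + 1 => 0
  | r + 1, 0 => (0 - l) * eulerCoeff l r 0
  | r + 1, n + 1 => ((n + 1 : ℕ) - l) * eulerCoeff l r (n + 1) + eulerCoeff l r n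

theorem eulerCoeff_of_lt (l : ℕ) {r n : ℕ} (h : r < n) : eulerCoeff l r n = 0 := by
  induction r generalizing n with
  | zero => obtain ⟨n, rfl⟩ := Nat.exists_eq_succ_of_ne_zero h.ne'; rfl
  | succ r ih =>
    obtain ⟨n, rfl⟩ := Nat.exists_eq_succ_of_ne_zero (Nat.ne_zero_of_lt h)
    rw [Nat.succ_eq_add_one, eulerCoeff, ih (by omega), ih (by omega), mul_zero, add_zero]

theorem eulerOp_iterate_div_pow {R : ℕ → ℝ → ℝ} {b : ℝ} {l k : ℕ}
    (hR : ∀ n < k, ∀ s ∈ Ioo 0 b, HasDerivAt (R n) (R (n + 1) s) s) {r : ℕ} (hr : r ≤ k) :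
    EqOn (eulerOp^[r] fun s => R 0 s / s ^ l)
      (fun s => ∑ n ∈ Finset.range (r + 1), eulerCoeff l r n * (s ^ n * R n s / s ^ l))
      (Ioo 0 b) := by
  induction r with
  | zero => intro s _; simp [eulerCoeff]
  | succ r ih =>
    intro s hs
    have hs0 : s ≠ 0 := hs.1.ne'
    rw [Function.iterate_succ_apply', eulerOp,
      Filter.EventuallyEq.deriv_eq (eventually_of_mem (isOpen_Ioo.mem_nhds hs) (ih (by omega)))]
    have hZ : ∀ n ∈ Finset.range (r + 1), HasDerivAt
        (fun s : ℝ => eulerCoeff l r n * (s ^ n * R n s / s ^ l))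
        (eulerCoeff l r n * (((n - l) * (s ^ n * R n s / s ^ l)
          + s ^ (n + 1) * R (n + 1) s / s ^ l) / s)) s := by
      intro n hn
      have hn' := Finset.mem_range.1 hn
      have h1 := (((hasDerivAt_pow n s).mul (hR n (by omega) s hs)).div (hasDerivAt_pow l s)
        (pow_ne_zero _ hs0)).const_mul (eulerCoeff l r n)
      refine h1.congr_deriv ?_
      congr 1
      have hp : ∀ i : ℕ, (i : ℝ) * s ^ (i - 1) = i * s ^ i / s := by
        intro i
        cases i with
        | zero => simp
        | succ i => rw [Nat.add_sub_cancel, pow_succ]; field_simp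
      rw [hp, hp]
      simp only [Pi.mul_apply]
      field_simp
      ring
    rw [(HasDerivAt.fun_sum hZ).deriv, Finset.mul_sum]
    have h2 : ∀ n ∈ Finset.range (r + 1), s * (eulerCoeff l r n *
        (((n - l) * (s ^ n * R n s / s ^ l) + s ^ (n + 1) * R (n + 1) s / s ^ l) / s))
        = (n - l) * eulerCoeff l r n * (s ^ n * R n s / s ^ l)
          + eulerCoeff l r n * (s ^ (n + 1) * R (n + 1) s / s ^ l) := by
      intro n _; field_simp
    rw [Finset.sum_congr rfl h2, Finset.sum_add_distrib]
    beta_reduce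
    rw [Finset.sum_range_succ' (n := r + 1)]
    simp only [eulerCoeff, add_mul, Finset.sum_add_distrib]
    rw [Finset.sum_range_succ' (n := r), Finset.sum_range_succ
      (f := fun n => ((n + 1 : ℕ) - l : ℝ) * eulerCoeff l r (n + 1)
        * (s ^ (n + 1) * R (n + 1) s / s ^ l)), eulerCoeff_of_lt l (Nat.lt_succ_self r)]
    push_cast
    ring

theorem contDiffOn_of_tower {D : ℕ → ℝ → ℝ} {b : ℝ} {k : ℕ}
    (hD : ∀ n ≤ k, ∀ s ∈ Ioo 0 b, HasDerivAt (D n) (D (n + 1) s) s) :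
    ContDiffOn ℝ k (D 0) (Ioo 0 b) := by
  induction k generalizing D with
  | zero =>
    rw [Nat.cast_zero, contDiffOn_zero]
    exact fun s hs => (hD 0 le_rfl s hs).continuousAt.continuousWithinAt
  | succ k ih =>
    rw [Nat.cast_add, Nat.cast_one, contDiffOn_succ_iff_deriv_of_isOpen isOpen_Ioo]
    refine ⟨fun s hs => (hD 0 (by omega) s hs).differentiableAt.differentiableWithinAt,
      fun h => by simp at h, ?_⟩
    refine (ih (D := fun n => D (n + 1)) fun n hn => hD (n + 1) (by omega)).congr ?_
    intro s hs
    exact (hD 0 (by omega) s hs).deriv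

/-- The constant of the uniform flatness of the remainder. -/
def eulerConst (l r : ℕ) : ℝ := ∑ n ∈ Finset.range (r + 1), |eulerCoeff l r n|

/-- A function `D 0` with derivatives `D n` bounded by `C` on `(0, b)` which have limits `d n`
at `0`: the remainder of its expansion of order `l`, divided by `s ^ l`, is regular and uniformly
flat. -/
theorem remainder_of_tower {D : ℕ → ℝ → ℝ} {d : ℕ → ℝ} {b C : ℝ} {l k : ℕ} (hb : b ≤ 1)
    (hD : ∀ n < l + k + 1, ∀ s ∈ Ioo 0 b, HasDerivAt (D n) (D (n + 1) s) s)
    (hC : ∀ n ≤ l + k + 1, ∀ s ∈ Ioo 0 b, |D n s| ≤ C)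
    (hlim : ∀ n ≤ l, Tendsto (D n) (𝓝[>] 0) (𝓝 (d n))) {h : ℝ → ℝ}
    (hh : ∀ s ∈ Ioo 0 b, h s
      = (D 0 s - ∑ j ∈ Finset.range (l + 1), d j / j.factorial * s ^ j) / s ^ l) :
    ContDiffOn ℝ k h (Ioo 0 b) ∧
      ∀ r ≤ k, ∀ s ∈ Ioo 0 b, |(eulerOp^[r] h) s| ≤ eulerConst l r * (C * s) := by
  set R : ℕ → ℝ → ℝ := fun n s => D n s - taylorDeriv l d n s with hRdef
  have hR : ∀ n < l + k + 1, ∀ s ∈ Ioo 0 b, HasDerivAt (R n) (R (n + 1) s) s :=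
    fun n hn s hs => (hD n hn s hs).sub (hasDerivAt_taylorDeriv l d n s)
  have hRlim : ∀ n ≤ l, Tendsto (R n) (𝓝[>] 0) (𝓝 0) := by
    intro n hn
    have h1 := (hasDerivAt_taylorDeriv l d n 0).continuousAt.tendsto.mono_left
      (nhdsWithin_le_nhds (s := Ioi 0))
    rw [taylorDeriv_at_zero hn] at h1
    simpa using (hlim n hn).sub h1
  have hRlt : ∀ n, l < n → R n = D n := by
    intro n hn; ext s; simp [hRdef, taylorDeriv_of_lt hn]
  have hhR : EqOn h (fun s => R 0 s / s ^ l) (Ioo 0 b) := by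
    intro s hs
    rw [hh s hs]
    simp only [hRdef, taylorDeriv, Nat.sub_zero, zero_add]
    congr 2
    exact Finset.sum_congr rfl fun i _ => by ring
  -- `s ^ n R⁽ⁿ⁾ = O(s ^ (l + 1))` for all `n`: by integration for `n ≤ l + 1`, trivially above
  have hbound : ∀ n ≤ k, ∀ s ∈ Ioo 0 b, |s ^ n * R n s / s ^ l| ≤ C * s := by
    intro n hn s hs
    have hs0 := hs.1
    have hC0 : 0 ≤ C := (abs_nonneg _).trans (hC 0 (by omega) s hs)
    rw [abs_div, abs_mul, abs_of_pos (pow_pos hs0 n), abs_of_pos (pow_pos hs0 l),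
      div_le_iff₀ (pow_pos hs0 l), mul_assoc, ← pow_succ']
    rcases Nat.lt_or_ge l n with hln | hln
    · rw [hRlt n hln, mul_comm]
      have h1 : s ^ n ≤ s ^ (l + 1) := pow_le_pow_of_le_one hs0.le (hs.2.le.trans hb) hln
      exact mul_le_mul (hC n (by omega) s hs) h1 (by positivity) hC0
    · have h1 := abs_le_mul_pow_of_tower (l := l) (i := l + 1 - n) (C := C)
        (fun n hn => hR n (by omega)) hRlim
        (fun s hs => by rw [hRlt _ (Nat.lt_succ_self l)]; exact hC _ (by omega) s hs) (by omega) hs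
      rw [show l + 1 - (l + 1 - n) = n by omega] at h1
      calc s ^ n * |R n s| ≤ s ^ n * (C * s ^ (l + 1 - n)) := by gcongr
        _ = C * (s ^ n * s ^ (l + 1 - n)) := by ring
        _ = C * s ^ (l + 1) := by rw [← pow_add]; congr 2; omega
  constructor
  · have h1 : ContDiffOn ℝ k (R 0) (Ioo 0 b) := contDiffOn_of_tower fun n hn => hR n (by omega)
    exact (h1.div (contDiff_id.pow l).contDiffOn fun s hs => pow_ne_zero _ hs.1.ne').congr hhR
  · intro r hr s hs
    rw [eulerOp_iterate_congr isOpen_Ioo hhR r hs,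
      eulerOp_iterate_div_pow (k := l + k + 1) hR (by omega) hs]
    refine (Finset.abs_sum_le_sum_abs _ _).trans ?_
    rw [eulerConst, Finset.sum_mul]
    refine Finset.sum_le_sum fun n hn => ?_
    rw [abs_mul]
    exact mul_le_mul_of_nonneg_left
      (hbound n (by have := Finset.mem_range.1 hn; omega) s hs) (abs_nonneg _)

/-! ### The passage along a trajectory -/

theorem hasDerivWithinAt_integral_Icc {f : ℝ → ℝ} {a b x : ℝ} (hf : ContinuousOn f (Icc a b))
    (hx : x ∈ Icc a b) : HasDerivWithinAt (fun u => ∫ t in a..u, f t) (f x) (Icc a b) x := by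
  have : Fact (x ∈ Icc a b) := ⟨hx⟩
  have hab : a ≤ b := hx.1.trans hx.2
  refine intervalIntegral.integral_hasDerivWithinAt_right ?_ ?_ (hf x hx)
  · exact (hf.mono (Icc_subset_Icc_right hx.2)).intervalIntegrable_of_Icc hx.1
  · exact hf.stronglyMeasurableAtFilter_nhdsWithin measurableSet_Icc x

theorem eq_of_hasDerivWithinAt_zero {f : ℝ → ℝ} {a b x : ℝ}
    (hf : ∀ x ∈ Icc a b, HasDerivWithinAt f 0 (Icc a b) x) (hx : x ∈ Icc a b) : f x = f a := by
  have := Convex.norm_image_sub_le_of_norm_hasDerivWithin_le (C := 0) hf (fun x _ => by simp)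
    (convex_Icc a b) (left_mem_Icc.2 (hx.1.trans hx.2)) hx
  rw [zero_mul] at this
  exact sub_eq_zero.1 (norm_le_zero_iff.1 this)

/-- `P` is positive between its zero `θ ≥ 0` and `1`, and `P` and `V` are smooth. -/
structure RegularAbove (θ : ℝ) (P V : ℝ → ℝ) : Prop where
  nonneg : 0 ≤ θ
  pos : ∀ x ∈ Ioc θ 1, 0 < P x
  contDiff_P : ContDiff ℝ ∞ P
  contDiffAt_V : ∀ x ∈ Icc (0 : ℝ) 1, ContDiffAt ℝ ∞ V x

/-- The ordinate at the abscissa `x` of the trajectory which starts at `(x₀, 1)`. -/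
noncomputable def orbitY (P V : ℝ → ℝ) (x₀ x : ℝ) : ℝ := Real.exp (-∫ z in x₀..x, V z / P z)

/-- The time `∫ g y ^ j / P dx` which a term `g(x) y ^ (j - 1)` of `U` contributes to the passage
from `(x₀, 1)` to `{x = 1}`. -/
noncomputable def transitTime (P V g : ℝ → ℝ) (j : ℕ) (x₀ : ℝ) : ℝ :=
  ∫ x in x₀..1, g x * orbitY P V x₀ x ^ j / P x

theorem orbitY_pos (P V : ℝ → ℝ) (x₀ x : ℝ) : 0 < orbitY P V x₀ x := Real.exp_pos _

namespace RegularAbove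

variable {θ : ℝ} {P V : ℝ → ℝ}

theorem mem_Icc (h : RegularAbove θ P V) {x : ℝ} (hx : x ∈ Ioc θ 1) : x ∈ Icc (0 : ℝ) 1 :=
  ⟨h.nonneg.trans hx.1.le, hx.2⟩

theorem continuousOn_div (h : RegularAbove θ P V) : ContinuousOn (fun x => V x / P x) (Ioc θ 1) :=
  fun x hx => (((h.contDiffAt_V x (h.mem_Icc hx)).continuousAt).div
    h.contDiff_P.continuous.continuousAt (h.pos x hx).ne').continuousWithinAt

theorem Icc_subset {x₀ : ℝ} (hx₀ : x₀ ∈ Ioc θ 1) : Icc x₀ 1 ⊆ Ioc θ 1 :=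
  fun _ hx => ⟨hx₀.1.trans_le hx.1, hx.2⟩

theorem intervalIntegrable (h : RegularAbove θ P V) {a b : ℝ} (ha : a ∈ Ioc θ 1)
    (hb : b ∈ Ioc θ 1) : IntervalIntegrable (fun x => V x / P x) MeasureTheory.volume a b :=
  (h.continuousOn_div.mono (fun _ hx =>
    ⟨(lt_min ha.1 hb.1).trans_le hx.1, hx.2.trans (max_le ha.2 hb.2)⟩)).intervalIntegrable

theorem orbitY_mul (h : RegularAbove θ P V) {a b c : ℝ} (ha : a ∈ Ioc θ 1) (hb : b ∈ Ioc θ 1)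
    (hc : c ∈ Ioc θ 1) : orbitY P V a b * orbitY P V b c = orbitY P V a c := by
  rw [orbitY, orbitY, orbitY, ← Real.exp_add, ← intervalIntegral.integral_add_adjacent_intervals
    (h.intervalIntegrable ha hb) (h.intervalIntegrable hb hc)]
  congr 1
  ring

theorem hasDerivWithinAt_orbitY (h : RegularAbove θ P V) {x₀ x : ℝ} (hx₀ : x₀ ∈ Ioc θ 1)
    (hx : x ∈ Icc x₀ 1) : HasDerivWithinAt (orbitY P V x₀) (-(V x * orbitY P V x₀ x) / P x)
      (Icc x₀ 1) x := by
  have h1 := (hasDerivWithinAt_integral_Icc (h.continuousOn_div.mono (Icc_subset hx₀)) hx).neg.exp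
  refine h1.congr_deriv ?_
  simp only [orbitY, Pi.neg_apply]
  ring

theorem continuousOn_orbitY (h : RegularAbove θ P V) {x₀ : ℝ} (hx₀ : x₀ ∈ Ioc θ 1) :
    ContinuousOn (orbitY P V x₀) (Icc x₀ 1) :=
  fun _ hx => (h.hasDerivWithinAt_orbitY hx₀ hx).continuousWithinAt

/-- The dependence of the trajectory on its starting point. -/
theorem hasDerivAt_orbitY_left (h : RegularAbove θ P V) {x b : ℝ} (hx : x ∈ Ioo θ 1)
    (hb : b ∈ Ioc θ 1) : HasDerivAt (fun z => orbitY P V z b) (V x * orbitY P V x b / P x) x := by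
  have hx' : x ∈ Ioc θ 1 := ⟨hx.1, hx.2.le⟩
  have h0 := h.continuousOn_div.mono Ioo_subset_Ioc_self
  have h1 := (intervalIntegral.integral_hasDerivAt_left (h.intervalIntegrable hx' hb)
    (h0.stronglyMeasurableAtFilter isOpen_Ioo x hx)
    (h0.continuousAt (isOpen_Ioo.mem_nhds hx))).neg.exp
  refine h1.congr_deriv ?_
  simp only [orbitY, Pi.neg_apply]
  ring

theorem continuousOn_integrand (h : RegularAbove θ P V) {g : ℝ → ℝ} (hg : Continuous g) (j : ℕ)
    {x₀ : ℝ} (hx₀ : x₀ ∈ Ioc θ 1) :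
    ContinuousOn (fun x => g x * orbitY P V x₀ x ^ j / P x) (Icc x₀ 1) :=
  (hg.continuousOn.mul ((h.continuousOn_orbitY hx₀).pow j)).div
    h.contDiff_P.continuous.continuousOn fun x hx => (h.pos x (Icc_subset hx₀ hx)).ne'

/-- The equation satisfied by the transit time as a function of the starting point. -/
theorem hasDerivAt_transitTime (h : RegularAbove θ P V) {g : ℝ → ℝ} (hg : Continuous g) (j : ℕ)
    {x : ℝ} (hx : x ∈ Ioo θ 1) :
    HasDerivAt (transitTime P V g j) ((j * V x * transitTime P V g j x - g x) / P x) x := by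
  -- the multiplicativity of `orbitY` moves the starting point out of the integral
  set b : ℝ := (θ + x) / 2 with hb
  have hbθ : b ∈ Ioc θ 1 := ⟨by linarith [hx.1], by linarith [hx.1, hx.2]⟩
  have hbx : b < x := by linarith [hx.1]
  have h1 : (1 : ℝ) ∈ Ioc θ 1 := ⟨hx.1.trans hx.2, le_rfl⟩
  have hcont := h.continuousOn_integrand hg j hbθ
  have hT : ∀ z ∈ Ioo b 1, transitTime P V g j z
      = (orbitY P V z b) ^ j * ∫ t in z..1, g t * orbitY P V b t ^ j / P t := by
    intro z hz
    have hz' : z ∈ Ioc θ 1 := ⟨hbθ.1.trans hz.1, hz.2.le⟩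
    rw [transitTime, ← intervalIntegral.integral_const_mul]
    refine intervalIntegral.integral_congr fun t ht => ?_
    rw [uIcc_of_le hz.2.le] at ht
    rw [← h.orbitY_mul hz' hbθ (Icc_subset hz' ht), mul_pow]
    ring
  have hx' : x ∈ Ioc θ 1 := ⟨hx.1, hx.2.le⟩
  have hint : HasDerivAt (fun z => ∫ t in z..1, g t * orbitY P V b t ^ j / P t)
      (-(g x * orbitY P V b x ^ j / P x)) x := by
    have h0 := hcont.mono (Ioo_subset_Icc_self)
    refine intervalIntegral.integral_hasDerivAt_left ?_
      (h0.stronglyMeasurableAtFilter isOpen_Ioo x ⟨hbx, hx.2⟩)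
      (h0.continuousAt (isOpen_Ioo.mem_nhds ⟨hbx, hx.2⟩))
    exact (hcont.mono (Icc_subset_Icc_left hbx.le)).intervalIntegrable_of_Icc hx.2.le
  have hprod := ((h.hasDerivAt_orbitY_left hx hbθ).pow j).mul hint
  have hprod' := hprod.congr_of_eventuallyEq
    (eventually_of_mem (isOpen_Ioo.mem_nhds ⟨hbx, hx.2⟩) hT : transitTime P V g j =ᶠ[𝓝 x] _)
  refine hprod'.congr_deriv ?_
  have e1 : orbitY P V x b * orbitY P V b x = 1 := by
    rw [h.orbitY_mul hx' hbθ hx', orbitY, intervalIntegral.integral_same, neg_zero, Real.exp_zero]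
  have e2 : orbitY P V x b ^ j * orbitY P V b x ^ j = 1 := by rw [← mul_pow, e1, one_pow]
  have hPx := (h.pos x hx').ne'
  rw [hT x ⟨hbx, hx.2⟩]
  simp only [Pi.pow_apply]
  rw [eq_div_iff hPx, add_mul]
  have e3 : orbitY P V x b ^ j * -(g x * orbitY P V b x ^ j / P x) * P x = -g x := by
    field_simp; linear_combination (-g x) * e2
  rw [e3]
  cases j with
  | zero => simp
  | succ j => rw [Nat.add_sub_cancel]; field_simp; push_cast; ring

theorem contDiffAt_transitTime (h : RegularAbove θ P V) {g : ℝ → ℝ} (hg : ContDiff ℝ ∞ g) (j : ℕ)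
    {x : ℝ} (hx : x ∈ Ioo θ 1) : ContDiffAt ℝ ∞ (transitTime P V g j) x := by
  suffices H : ContDiffOn ℝ ∞ (transitTime P V g j) (Ioo θ 1) from
    H.contDiffAt (isOpen_Ioo.mem_nhds hx)
  have hd := fun {z} (hz : z ∈ Ioo θ 1) => h.hasDerivAt_transitTime hg.continuous j hz
  have hV : ContDiffOn ℝ ∞ V (Ioo θ 1) := fun z hz =>
    (h.contDiffAt_V z (h.mem_Icc ⟨hz.1, hz.2.le⟩)).contDiffWithinAt
  rw [contDiffOn_infty]
  intro n
  induction n with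
  | zero =>
    rw [Nat.cast_zero, contDiffOn_zero]
    exact fun z hz => (hd hz).continuousAt.continuousWithinAt
  | succ n ih =>
    have hn : ((n : ℕ∞) : WithTop ℕ∞) ≤ ∞ := by exact_mod_cast le_top
    rw [Nat.cast_add, Nat.cast_one, contDiffOn_succ_iff_deriv_of_isOpen isOpen_Ioo]
    refine ⟨fun z hz => (hd hz).differentiableAt.differentiableWithinAt, fun h => by simp at h, ?_⟩
    have h1 : ContDiffOn ℝ n
        (fun z => (j * V z * transitTime P V g j z - g z) / P z) (Ioo θ 1) :=
      (((contDiffOn_const.mul (hV.of_le hn)).mul ih).sub (hg.of_le hn).contDiffOn).div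
        (h.contDiff_P.of_le hn).contDiffOn fun z hz => (h.pos z ⟨hz.1, hz.2.le⟩).ne'
    exact h1.congr fun z hz => (hd hz).deriv

/-- A passage follows the trajectory `orbitY`. -/
theorem passage_eq_orbitY (h : RegularAbove θ P V) {U : ℝ → ℝ → ℝ} {x₀ : ℝ} {y t : ℝ → ℝ}
    (hx₀ : x₀ ∈ Ioc θ 1) (hp : IsPassage P V U x₀ y t) {x : ℝ} (hx : x ∈ Icc x₀ 1) :
    y x = orbitY P V x₀ x := by
  have h1 : ∀ z ∈ Icc x₀ 1, HasDerivWithinAt (fun z => y z / orbitY P V x₀ z) 0 (Icc x₀ 1) z := by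
    intro z hz
    have hne := (orbitY_pos P V x₀ z).ne'
    refine ((hp.orbit z hz).div (h.hasDerivWithinAt_orbitY hx₀ hz) hne).congr_deriv ?_
    rw [div_eq_zero_iff]
    left; ring
  have h2 := eq_of_hasDerivWithinAt_zero h1 hx
  have h3 : orbitY P V x₀ x₀ = 1 := by
    rw [orbitY, intervalIntegral.integral_same, neg_zero, Real.exp_zero]
  rw [hp.y_start, h3, div_one, div_eq_one_iff_eq (orbitY_pos P V x₀ x).ne'] at h2
  exact h2

theorem dulacTime_unique (h : RegularAbove θ P V) {U : ℝ → ℝ → ℝ} {x₀ τ τ' : ℝ}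
    (hx₀ : x₀ ∈ Ioc θ 1) (hτ : IsDulacTime P V U x₀ τ) (hτ' : IsDulacTime P V U x₀ τ') :
    τ = τ' := by
  obtain ⟨y, t, hp, rfl⟩ := hτ
  obtain ⟨y', t', hp', rfl⟩ := hτ'
  have h1 : ∀ z ∈ Icc x₀ 1, HasDerivWithinAt (fun z => t z - t' z) 0 (Icc x₀ 1) z := by
    intro z hz
    refine ((hp.time z hz).sub (hp'.time z hz)).congr_deriv ?_
    rw [h.passage_eq_orbitY hx₀ hp hz, h.passage_eq_orbitY hx₀ hp' hz, sub_self]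
  have h2 := eq_of_hasDerivWithinAt_zero h1 (right_mem_Icc.2 hx₀.2)
  rw [hp.t_start, hp'.t_start, sub_self] at h2
  exact sub_eq_zero.1 h2

/-- The Dulac time is the sum of the transit times of the monomials of `U`. -/
theorem isDulacTime_tsum (h : RegularAbove θ P V) {x₀ : ℝ} (hx₀ : x₀ ∈ Ioc θ 1)
    (hy : ∀ x ∈ Icc x₀ 1, orbitY P V x₀ x ≤ 1) (m : ℕ) {F : ℝ → ℝ → ℝ} {u : ℕ × ℕ → ℝ}
    (hu : Summable fun p => |u p|)
    (hF : ∀ x y : ℝ, |x| ≤ 1 → |y| ≤ 1 →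
      HasSum (fun p : ℕ × ℕ => u p * x ^ p.1 * y ^ p.2) (F x y)) :
    IsDulacTime P V (fun x y => x ^ m * F x y) x₀
      (∑' p, u p * transitTime P V (fun x => x ^ (m + p.1)) (p.2 + 1) x₀) := by
  have hx1 : ∀ x ∈ Icc x₀ 1, |x| ≤ 1 := fun x hx => by
    have := h.mem_Icc (Icc_subset hx₀ hx)
    rw [abs_of_nonneg this.1]; exact this.2
  have hy1 : ∀ x ∈ Icc x₀ 1, |orbitY P V x₀ x| ≤ 1 := fun x hx => by
    rw [abs_of_pos (orbitY_pos _ _ _ _)]; exact hy x hx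
  have hterm : ∀ (p : ℕ × ℕ), ∀ x ∈ Icc x₀ 1,
      ‖u p * x ^ p.1 * orbitY P V x₀ x ^ p.2‖ ≤ |u p| := by
    intro p x hx
    rw [Real.norm_eq_abs, abs_mul, abs_mul, abs_pow, abs_pow, mul_assoc]
    exact mul_le_of_le_one_right (abs_nonneg _) (mul_le_one₀ (pow_le_one₀ (abs_nonneg _) (hx1 x hx))
      (by positivity) (pow_le_one₀ (abs_nonneg _) (hy1 x hx)))
  have hFc : ContinuousOn (fun x => F x (orbitY P V x₀ x)) (Icc x₀ 1) := by
    have : ContinuousOn (fun x => ∑' p : ℕ × ℕ, u p * x ^ p.1 * orbitY P V x₀ x ^ p.2)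
        (Icc x₀ 1) := continuousOn_tsum (fun p => (continuousOn_const.mul
          (continuous_pow _).continuousOn).mul ((h.continuousOn_orbitY hx₀).pow _)) hu hterm
    exact this.congr fun x hx => (hF x _ (hx1 x hx) (hy1 x hx)).tsum_eq.symm
  have hPc : ContinuousOn (fun x => 1 / P x) (Icc x₀ 1) :=
    continuousOn_const.div h.contDiff_P.continuous.continuousOn
      fun x hx => (h.pos x (Icc_subset hx₀ hx)).ne'
  have hfc : ContinuousOn (fun x => orbitY P V x₀ x * (x ^ m * F x (orbitY P V x₀ x)) / P x)
      (Icc x₀ 1) :=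
    ((h.continuousOn_orbitY hx₀).mul ((continuous_pow m).continuousOn.mul hFc)).div
      h.contDiff_P.continuous.continuousOn fun x hx => (h.pos x (Icc_subset hx₀ hx)).ne'
  refine ⟨orbitY P V x₀, fun x => ∫ z in x₀..x,
    orbitY P V x₀ z * (z ^ m * F z (orbitY P V x₀ z)) / P z, ⟨?_, ?_, hy1, ?_, ?_⟩, ?_⟩
  · rw [orbitY, intervalIntegral.integral_same, neg_zero, Real.exp_zero]
  · exact intervalIntegral.integral_same
  · exact fun x hx => h.hasDerivWithinAt_orbitY hx₀ hx
  · exact fun x hx => hasDerivWithinAt_integral_Icc hfc hx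
  · have hsum := intervalIntegral.hasSum_integral_of_dominated_convergence (a := x₀) (b := 1)
      (μ := MeasureTheory.volume)
      (F := fun (p : ℕ × ℕ) x => u p * (x ^ (m + p.1) * orbitY P V x₀ x ^ (p.2 + 1) / P x))
      (f := fun z => orbitY P V x₀ z * (z ^ m * F z (orbitY P V x₀ z)) / P z)
      (fun p x => |u p| * (1 / P x)) ?_ ?_ ?_ ?_ ?_
    · simp only [intervalIntegral.integral_const_mul] at hsum
      exact hsum.tsum_eq.symm
    · intro p
      rw [uIoc_of_le hx₀.2]
      exact ((continuousOn_const.mul (h.continuousOn_integrand (continuous_pow (m + p.1)) (p.2 + 1)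
        hx₀)).mono Ioc_subset_Icc_self).aestronglyMeasurable measurableSet_Ioc
    · refine fun p => Eventually.of_forall fun x hx => ?_
      rw [uIoc_of_le hx₀.2] at hx
      have hx' : x ∈ Icc x₀ 1 := ⟨hx.1.le, hx.2⟩
      have hPx := h.pos x (Icc_subset hx₀ hx')
      rw [Real.norm_eq_abs, abs_mul, abs_div, abs_of_pos hPx, abs_mul, abs_pow, abs_pow]
      gcongr
      exact mul_le_one₀ (pow_le_one₀ (abs_nonneg _) (hx1 x hx'))
        (by positivity) (pow_le_one₀ (abs_nonneg _) (hy1 x hx'))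
    · exact Eventually.of_forall fun x _ => hu.mul_right _
    · simp only [tsum_mul_right]
      exact (continuousOn_const.mul hPc).intervalIntegrable_of_Icc hx₀.2
    · refine Eventually.of_forall fun x hx => ?_
      rw [uIoc_of_le hx₀.2] at hx
      have hx' : x ∈ Icc x₀ 1 := ⟨hx.1.le, hx.2⟩
      have := (hF x _ (hx1 x hx') (hy1 x hx')).mul_left (orbitY P V x₀ x * x ^ m / P x)
      rw [show orbitY P V x₀ x * x ^ m / P x * F x (orbitY P V x₀ x)
        = orbitY P V x₀ x * (x ^ m * F x (orbitY P V x₀ x)) / P x by ring] at this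
      have e : (fun p : ℕ × ℕ => u p * (x ^ (m + p.1) * orbitY P V x₀ x ^ (p.2 + 1) / P x))
          = fun p => orbitY P V x₀ x * x ^ m / P x * (u p * x ^ p.1 * orbitY P V x₀ x ^ p.2) :=
        funext fun p => by ring
      rw [e]
      exact this

/-- Beyond `b` the ordinate grows at most by a fixed factor, even if `V` becomes negative there. -/
theorem orbitY_le_exp (h : RegularAbove θ P V) {b D : ℝ} (hb : b ∈ Ioc θ 1)
    (hD : ∀ x ∈ Icc b 1, |V x / P x| ≤ D) {x : ℝ} (hx : x ∈ Icc b 1) :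
    orbitY P V b x ≤ Real.exp D := by
  rw [orbitY, Real.exp_le_exp]
  have hD0 : 0 ≤ D := (abs_nonneg _).trans (hD x hx)
  have h1 := intervalIntegral.norm_integral_le_of_norm_le_const (a := b) (b := x) (C := D)
    (f := fun z => V z / P z) (fun z hz => by
      rw [uIoc_of_le hx.1] at hz
      exact hD z ⟨hz.1.le, hz.2.trans hx.2⟩)
  rw [Real.norm_eq_abs, abs_of_nonneg (sub_nonneg.2 hx.1)] at h1
  have h2 : x - b ≤ 1 := by linarith [h.nonneg, hb.1, hx.2]
  have h3 : D * (x - b) ≤ D := mul_le_of_le_one_right hD0 h2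
  exact (neg_le_abs _).trans (h1.trans h3)

/-- The transit times from a point `b` away from the separatrix grow at most geometrically in `j`. -/
theorem abs_transitTime_le (h : RegularAbove θ P V) {b D E : ℝ} (hb : b ∈ Ioc θ 1)
    (hD : ∀ x ∈ Icc b 1, |V x / P x| ≤ D) (hE : ∀ x ∈ Icc b 1, 1 / P x ≤ E) (hE1 : 1 ≤ E)
    {g : ℝ → ℝ} (hg : ∀ x ∈ Icc b 1, |g x| ≤ 1) {j : ℕ} (hj : 1 ≤ j) :
    |transitTime P V g j b| ≤ (Real.exp D * E) ^ j := by
  have h1 := intervalIntegral.norm_integral_le_of_norm_le_const (a := b) (b := 1)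
    (C := Real.exp D ^ j * E) (f := fun x => g x * orbitY P V b x ^ j / P x) (fun x hx => by
      rw [uIoc_of_le hb.2] at hx
      have hx' : x ∈ Icc b 1 := ⟨hx.1.le, hx.2⟩
      have h2 := h.orbitY_le_exp hb hD hx'
      have hPx := h.pos x (Icc_subset hb hx')
      have h3 := hE x hx'
      rw [Real.norm_eq_abs, abs_div, abs_mul, abs_pow, abs_of_pos hPx, abs_of_pos (orbitY_pos _ _ _ _),
        div_eq_mul_one_div]
      have h4 : |g x| * orbitY P V b x ^ j ≤ 1 * Real.exp D ^ j :=
        mul_le_mul (hg x hx') (pow_le_pow_left₀ (orbitY_pos _ _ _ _).le h2 j)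
          (pow_nonneg (orbitY_pos _ _ _ _).le _) zero_le_one
      rw [one_mul] at h4
      exact mul_le_mul h4 h3 (by positivity) (by positivity))
  rw [Real.norm_eq_abs, abs_of_nonneg (sub_nonneg.2 hb.2)] at h1
  have h2 : 1 - b ≤ 1 := by linarith [h.nonneg, hb.1]
  refine h1.trans ((mul_le_of_le_one_right (by positivity) h2).trans ?_)
  rw [mul_pow]
  gcongr
  exact le_self_pow₀ hE1 (by omega)

/-- A trajectory which starts close enough to the separatrix stays inside `{y ≤ 1}`. -/
theorem orbitY_le_one (h : RegularAbove θ P V) {b D v : ℝ} (hb : b ∈ Ioo θ 1) (hv : 0 < v)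
    (hD : ∀ x ∈ Icc b 1, |V x / P x| ≤ D) (hV : ∀ x ∈ Ioc θ b, v ≤ V x)
    (hP : ∀ x ∈ Ioc θ b, P x ≤ v / 2 * (x - θ)) {x₀ : ℝ} (hx₀ : x₀ ∈ Ioc θ b)
    (hsmall : (x₀ - θ) * Real.exp D ≤ b - θ) {x : ℝ} (hx : x ∈ Icc x₀ 1) :
    orbitY P V x₀ x ≤ 1 := by
  have hb' : b ∈ Ioc θ 1 := ⟨hb.1, hb.2.le⟩
  have hsub : ∀ {z}, z ∈ Ioc θ b → z ∈ Ioo θ 1 := fun hz => ⟨hz.1, hz.2.trans_lt hb.2⟩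
  have hx₀' := hsub hx₀
  rcases le_total x b with hxb | hxb
  · rw [orbitY, Real.exp_le_one_iff, neg_nonpos]
    refine intervalIntegral.integral_nonneg hx.1 fun z hz => ?_
    have hz' : z ∈ Ioc θ b := ⟨hx₀.1.trans_le hz.1, hz.2.trans hxb⟩
    exact div_nonneg (hv.le.trans (hV z hz')) (h.pos z ⟨hz'.1, (hsub hz').2.le⟩).le
  · rw [← h.orbitY_mul ⟨hx₀'.1, hx₀'.2.le⟩ hb' ⟨hb.1.trans_le hxb, hx.2⟩]
    have h1 := h.orbitY_le_exp hb' hD ⟨hxb, hx.2⟩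
    have h2 := le_of_singular_ode (P := P) (w := V) (f := fun _ => 0) (F := 0) (C := 1) (q := 1)
      (κ := v) (b := b) (R := fun z => orbitY P V z b) (R' := fun z => V z * orbitY P V z b / P z)
      le_rfl hv zero_le_one le_rfl (fun z hz => h.hasDerivAt_orbitY_left (hsub hz) hb')
      (fun z hz => by
        have := (h.pos z ⟨hz.1, (hsub hz).2.le⟩).ne'
        field_simp; ring)
      (fun z hz => h.pos z ⟨hz.1, (hsub hz).2.le⟩)
      (fun z hz => by
        have h3 := hP z hz
        have h4 := hV z hz
        have h5 : 0 < z - θ := sub_pos.2 hz.1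
        rw [Nat.cast_one, one_mul]
        exact h3.trans (by gcongr; linarith))
      hV (fun _ _ => le_rfl)
      (by rw [orbitY, intervalIntegral.integral_same, neg_zero, Real.exp_zero]) hx₀
    have hbθ : 0 < b - θ := sub_pos.2 hb.1
    rw [zero_div, zero_add, one_mul, pow_one] at h2
    calc orbitY P V x₀ b * orbitY P V b x ≤ (x₀ - θ) / (b - θ) * Real.exp D :=
          mul_le_mul h2 h1 (orbitY_pos _ _ _ _).le (div_nonneg (sub_pos.2 hx₀.1).le hbθ.le)
      _ = (x₀ - θ) * Real.exp D / (b - θ) := by ring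
      _ ≤ 1 := (div_le_one hbθ).2 hsmall

end RegularAbove

/-! ### Uniformity in the parameters -/

theorem bigRoot_eq {μ : ℕ} (hμ : 1 ≤ μ) (ε : ℝ) : bigRoot μ ε = max ε 0 ^ ((1 : ℝ) / μ) := by
  unfold bigRoot
  have : (1 : ℝ) / μ ≠ 0 := by positivity
  split_ifs with h
  · rw [max_eq_right h, Real.zero_rpow this]
  · rw [max_eq_left (not_le.1 h).le]

theorem bigRoot_nonneg {μ : ℕ} (hμ : 1 ≤ μ) (ε : ℝ) : 0 ≤ bigRoot μ ε := by
  rw [bigRoot_eq hμ]; exact Real.rpow_nonneg (le_max_right _ _) _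

theorem bigRoot_of_nonpos (μ : ℕ) {ε : ℝ} (hε : ε ≤ 0) : bigRoot μ ε = 0 := if_pos hε

theorem bigRoot_pow {μ : ℕ} (hμ : 1 ≤ μ) (ε : ℝ) : bigRoot μ ε ^ μ = max ε 0 := by
  rw [bigRoot_eq hμ, one_div, Real.rpow_inv_natCast_pow (le_max_right _ _) (by omega)]

theorem continuous_bigRoot {μ : ℕ} (hμ : 1 ≤ μ) : Continuous (bigRoot μ) := by
  rw [show bigRoot μ = fun ε => max ε 0 ^ ((1 : ℝ) / μ) from funext (bigRoot_eq hμ)]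
  exact (continuous_id.max continuous_const).rpow_const fun _ => Or.inr (by positivity)

theorem unfoldingP_bigRoot {μ : ℕ} (hμ : 1 ≤ μ) (ε : ℝ) :
    unfoldingP μ ε (bigRoot μ ε) = 0 := by
  rw [unfoldingP, bigRoot_pow hμ]
  rcases le_total ε 0 with h | h
  · rw [bigRoot_of_nonpos μ h, zero_mul]
  · rw [max_eq_left h, sub_self, mul_zero]

theorem pow_le_unfoldingP {μ : ℕ} (hμ : 1 ≤ μ) {ε x : ℝ} (hx : bigRoot μ ε < x) :
    (x - bigRoot μ ε) ^ (μ + 1) ≤ unfoldingP μ ε x := by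
  have h0 := bigRoot_nonneg hμ ε
  have h1 : 0 ≤ x - bigRoot μ ε := sub_nonneg.2 hx.le
  have h2 := pow_add_pow_le h1 h0 (n := μ) (by omega)
  rw [sub_add_cancel, bigRoot_pow hμ] at h2
  have h3 : (x - bigRoot μ ε) ^ μ ≤ x ^ μ - ε := by linarith [le_max_left ε 0]
  rw [pow_succ', unfoldingP]
  exact mul_le_mul (by linarith) h3 (pow_nonneg h1 _) (by linarith)

theorem contDiff_unfoldingP (μ : ℕ) (ε : ℝ) : ContDiff ℝ ∞ (unfoldingP μ ε) := by
  unfold unfoldingP; fun_prop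

theorem hasDerivAt_unfoldingP (μ : ℕ) (ε x : ℝ) :
    HasDerivAt (unfoldingP μ ε) ((μ + 1) * x ^ μ - ε) x := by
  have h1 : HasDerivAt (fun x : ℝ => x ^ (μ + 1) - ε * x) ((μ + 1 : ℕ) * x ^ (μ + 1 - 1) - ε * 1) x :=
    (hasDerivAt_pow (μ + 1) x).sub ((hasDerivAt_id x).const_mul ε)
  have h2 : unfoldingP μ ε = fun x : ℝ => x ^ (μ + 1) - ε * x := by
    ext x; rw [unfoldingP]; ring
  rw [h2]
  refine h1.congr_deriv ?_
  push_cast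
  rw [mul_one]

theorem abs_deriv_unfoldingP_le {μ : ℕ} (hμ : 1 ≤ μ) {ε x ρ : ℝ} (hx : x ∈ Icc 0 ρ) (hρ : ρ ≤ 1)
    (hε : |ε| ≤ ρ) : |deriv (unfoldingP μ ε) x| ≤ (μ + 2) * ρ := by
  rw [(hasDerivAt_unfoldingP μ ε x).deriv]
  have h1 : x ^ μ ≤ ρ := (pow_le_of_le_one hx.1 (hx.2.trans hρ) (by omega)).trans hx.2
  refine (abs_sub _ _).trans ?_
  rw [abs_of_nonneg (by have := hx.1; positivity : (0 : ℝ) ≤ (μ + 1) * x ^ μ)]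
  nlinarith

theorem continuous_iteratedDeriv_unfoldingP (μ n : ℕ) :
    Continuous fun p : ℝ × ℝ => iteratedDeriv n (unfoldingP μ p.2) p.1 := by
  refine continuous_iff_continuousAt.2 fun p => ?_
  have h : AnalyticAt ℝ (fun q : ℝ × ℝ => unfoldingP μ q.2 q.1) p := by
    unfold unfoldingP
    exact analyticAt_fst.mul ((analyticAt_fst.pow μ).sub analyticAt_snd)
  exact (analyticAt_iteratedDeriv_fst h n).continuousAt

/-- A bound for the derivatives of order at most `n` of `x ^ q` on `[0, 1/2]`. -/
noncomputable def powBound (n q : ℕ) : ℝ := 2 ^ n * (q + 1) ^ n / 2 ^ q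

theorem abs_iteratedDeriv_pow_le {n i q : ℕ} (hi : i ≤ n) {x : ℝ} (hx : x ∈ Icc (0 : ℝ) (1 / 2)) :
    |iteratedDeriv i (fun x : ℝ => x ^ q) x| ≤ powBound n q := by
  rw [iteratedDeriv_pow, powBound]
  rcases Nat.lt_or_ge q i with hq | hq
  · rw [Nat.descFactorial_of_lt hq, Nat.cast_zero, zero_mul, abs_zero]; positivity
  have h0 : (0 : ℝ) ≤ x := hx.1
  rw [abs_of_nonneg (by positivity), le_div_iff₀ (by positivity)]
  have h1 : (q.descFactorial i : ℝ) ≤ (q + 1) ^ n := by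
    have h2 : (q.descFactorial i : ℝ) ≤ (q : ℝ) ^ i := by exact_mod_cast Nat.descFactorial_le_pow q i
    calc (q.descFactorial i : ℝ) ≤ (q : ℝ) ^ i := h2
      _ ≤ (q + 1 : ℝ) ^ i := by gcongr; linarith
      _ ≤ (q + 1 : ℝ) ^ n := pow_le_pow_right₀ (by linarith [(Nat.cast_nonneg q : (0 : ℝ) ≤ q)]) hi
  have h3 : x ^ (q - i) * 2 ^ q ≤ 2 ^ n := by
    calc x ^ (q - i) * 2 ^ q ≤ (1 / 2) ^ (q - i) * 2 ^ q := by gcongr; exact hx.2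
      _ = (1 / 2 * 2) ^ (q - i) * 2 ^ i := by
        rw [mul_pow, mul_assoc, ← pow_add, Nat.sub_add_cancel hq]
      _ = 2 ^ i := by norm_num
      _ ≤ 2 ^ n := pow_le_pow_right₀ (by norm_num) hi
  calc (q.descFactorial i : ℝ) * x ^ (q - i) * 2 ^ q
      = (q.descFactorial i : ℝ) * (x ^ (q - i) * 2 ^ q) := by ring
    _ ≤ (q + 1) ^ n * 2 ^ n := by gcongr
    _ = _ := mul_comm _ _

theorem tendsto_powBound (n : ℕ) : Tendsto (powBound n) atTop (𝓝 0) := by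
  have h1 := (tendsto_pow_const_div_const_pow_of_one_lt n (r := (2 : ℝ)) (by norm_num)).comp
    (tendsto_add_atTop_nat 1)
  have h2 := h1.const_mul ((2 : ℝ) ^ n * 2)
  rw [mul_zero] at h2
  refine h2.congr fun q => ?_
  simp only [Function.comp, powBound]
  rw [pow_succ (2 : ℝ) q]
  push_cast
  field_simp

theorem exists_powBound_le (n : ℕ) : ∃ M ≥ 0, ∀ q, powBound n q ≤ M := by
  obtain ⟨M, hM⟩ := (tendsto_powBound n).bddAbove_range
  exact ⟨M, (by unfold powBound; positivity : 0 ≤ powBound n 0).trans (hM ⟨0, rfl⟩),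
    fun q => hM ⟨q, rfl⟩⟩

theorem exists_bound_of_isCompact {X : Type*} [TopologicalSpace X] {S : Set X} (hS : IsCompact S)
    {f : ℕ → X → ℝ} (hf : ∀ n, ContinuousOn (f n) S) (N : ℕ) :
    ∃ M ≥ 0, ∀ n ≤ N, ∀ p ∈ S, |f n p| ≤ M := by
  choose C hC using fun n => hS.exists_bound_of_continuousOn (hf n)
  refine ⟨∑ n ∈ Finset.range (N + 1), |C n|, Finset.sum_nonneg fun _ _ => abs_nonneg _, ?_⟩
  intro n hn p hp
  refine (hC n p hp).trans ((le_abs_self _).trans ?_)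
  exact Finset.single_le_sum (f := fun n => |C n|) (fun _ _ => abs_nonneg _)
    (Finset.mem_range.2 (by omega))

section Parameters

variable {E : Type*} [NormedAddCommGroup E] [NormedSpace ℝ E] {A K : Set E} {V : E → ℝ → ℝ}

theorem continuousOn_iteratedDeriv_V
    (hV : AnalyticOnNhd ℝ (fun p : ℝ × E => V p.2 p.1) (Icc (-1) 1 ×ˢ A)) (n : ℕ) :
    ContinuousOn (fun p : ℝ × E => iteratedDeriv n (V p.2) p.1) (Icc (-1) 1 ×ˢ A) :=
  fun p hp => (analyticAt_iteratedDeriv_fst (hV p hp) n).continuousAt.continuousWithinAt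

theorem contDiffAt_V
    (hV : AnalyticOnNhd ℝ (fun p : ℝ × E => V p.2 p.1) (Icc (-1) 1 ×ˢ A)) {a : E} (ha : a ∈ A)
    {x : ℝ} (hx : x ∈ Icc (0 : ℝ) 1) : ContDiffAt ℝ ∞ (V a) x := by
  have h1 := hV (x, a) ⟨⟨by linarith [hx.1], hx.2⟩, ha⟩
  have h2 : AnalyticAt ℝ (fun z : ℝ => (z, a)) x := analyticAt_id.prod analyticAt_const
  have h3 : AnalyticAt ℝ (V a) x := h1.comp_of_eq h2 rfl
  exact h3.contDiffAt

/-- A neighbourhood of the corner on which `V` is uniformly positive. -/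
theorem exists_le_V (hV : AnalyticOnNhd ℝ (fun p : ℝ × E => V p.2 p.1) (Icc (-1) 1 ×ˢ A))
    (hV0 : ∀ a ∈ A, 0 < V a 0) (hK : IsCompact K) (hKA : K ⊆ A) :
    ∃ v > 0, ∃ η > 0, ∀ a ∈ K, ∀ x ∈ Icc (0 : ℝ) 1, x < η → v ≤ V a x := by
  have hc : ContinuousOn (fun p : ℝ × E => V p.2 p.1) (Icc (-1) 1 ×ˢ K) :=
    (hV.mono (prod_mono le_rfl hKA)).continuousOn
  have h0 : ∀ a ∈ K, ((0 : ℝ), a) ∈ Icc (-1 : ℝ) 1 ×ˢ K := fun a ha =>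
    ⟨⟨by norm_num, by norm_num⟩, ha⟩
  obtain ⟨w, hw, hwV⟩ := hK.exists_forall_le' (f := fun a => V a 0) (a := 0)
    (hc.comp (f := fun a : E => ((0 : ℝ), a)) (by fun_prop) h0) (fun a ha => hV0 a (hKA ha))
  obtain ⟨η, hη, hu⟩ := Metric.uniformContinuousOn_iff.1
    ((isCompact_Icc.prod hK).uniformContinuousOn_of_continuous hc) (w / 2) (by positivity)
  refine ⟨w / 2, by positivity, η, hη, fun a ha x hx hxη => ?_⟩
  have h1 := hu (x, a) ⟨⟨by linarith [hx.1], hx.2⟩, ha⟩ (0, a) (h0 a ha) (by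
    rw [Prod.dist_eq, dist_self, max_eq_left dist_nonneg, Real.dist_eq, sub_zero,
      abs_of_nonneg hx.1]
    exact hxη)
  rw [Real.dist_eq] at h1
  have h2 := hwV a ha
  have h3 := (abs_lt.1 h1).1
  simp only at h2 h3
  linarith

/-- The properties, for the parameters `(ε, a)`, of the equations satisfied by the transit times of
all monomials. The constants, which are those of `SingularODE` and a bound `D` for `V / P` beyond
`ϑ + δ`, are meant to be common to all `(ε, a)` in a compact set. -/
structure UniformData (μ N : ℕ) (v M B δ D ε : ℝ) (W : ℝ → ℝ) : Prop where
  root_add_le : bigRoot μ ε + δ ≤ 1 / 2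
  regular : RegularAbove (bigRoot μ ε) (unfoldingP μ ε) W
  abs_div_le : ∀ x ∈ Icc (bigRoot μ ε + δ) 1, |W x / unfoldingP μ ε x| ≤ D
  bound_P : ∀ n ≤ N + 1, |iteratedDeriv n (unfoldingP μ ε) (bigRoot μ ε)| ≤ M
  bound_V : ∀ n ≤ N + 1, |iteratedDeriv n W (bigRoot μ ε)| ≤ M
  weight : ∀ j : ℕ, 1 ≤ j → ∀ n ≤ N, j * (v / 2) ≤ j * iteratedDeriv 0 W (bigRoot μ ε)
    - n * iteratedDeriv 1 (unfoldingP μ ε) (bigRoot μ ε)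
  singularODE : ∀ q j : ℕ, 1 ≤ j → SingularODE μ N v M B δ (bigRoot μ ε) (unfoldingP μ ε) W
    (fun x => x ^ q) (transitTime (unfoldingP μ ε) W (fun x => x ^ q) j) j

/-- Resonances `j V(ϑ) = n P'(ϑ)` of order at most `N` are avoided, and all the estimates are
uniform, if `ε` is small: then `P'` is small on a neighbourhood of `ϑ` on which `V` is not. -/
theorem exists_uniformData {μ : ℕ} (hμ : 1 ≤ μ)
    (hV : AnalyticOnNhd ℝ (fun p : ℝ × E => V p.2 p.1) (Icc (-1) 1 ×ˢ A))
    (hV0 : ∀ a ∈ A, 0 < V a 0) (hK : IsCompact K) (hKA : K ⊆ A) (N : ℕ) :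
    ∃ v > 0, ∃ M ≥ 0, ∃ B ≥ 1, ∃ δ > 0, ∃ D : ℝ, ∃ ε₀ > 0, ∀ ε ∈ Icc (-ε₀) ε₀, ∀ a ∈ K,
      UniformData μ N v M B δ D ε (V a) := by
  obtain ⟨v, hv, η, hη, hvV⟩ := exists_le_V hV hV0 hK hKA
  obtain ⟨M₁, hM₁, hM₁V⟩ := exists_bound_of_isCompact ((isCompact_Icc (a := (-1 : ℝ)) (b := 1)).prod hK)
    (fun n => (continuousOn_iteratedDeriv_V hV n).mono (prod_mono le_rfl hKA)) (N + 1)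
  obtain ⟨M₂, hM₂, hM₂P⟩ := exists_bound_of_isCompact
    ((isCompact_Icc (a := (-1 : ℝ)) (b := 1)).prod (isCompact_Icc (a := (-1 : ℝ)) (b := 1)))
    (fun n => (continuous_iteratedDeriv_unfoldingP μ n).continuousOn) (N + 1)
  obtain ⟨M₃, hM₃, hM₃g⟩ := exists_powBound_le (N + 1)
  set M := M₁ + M₂ + M₃ with hM
  -- `ρ` bounds `ε` and the abscissas: there `V ≥ v` and `(N + 1) |P'| ≤ (N + 1) (μ + 2) ρ ≤ v / 2`
  set ρ : ℝ := min (1 / 2) (min (η / 2) (v / (2 * ((N + 1) * (μ + 2))))) with hρdef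
  have hρ0 : 0 < ρ := by positivity
  have hρ1 : ρ ≤ 1 / 2 := min_le_left _ _
  have hρη : ρ < η := ((min_le_right _ _).trans (min_le_left _ _)).trans_lt (by linarith)
  have hρv : (N + 1) * ((μ + 2) * ρ) ≤ v / 2 := by
    have : ρ ≤ v / (2 * ((N + 1) * (μ + 2))) := (min_le_right _ _).trans (min_le_right _ _)
    rw [le_div_iff₀ (by positivity)] at this
    linarith
  set δ : ℝ := ρ / 2 with hδdef
  have hδ0 : 0 < δ := by positivity
  set D : ℝ := M / δ ^ (μ + 1) with hD
  set L : ℝ := max 1 (1 / δ ^ (μ + 1)) with hL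
  have hD0 : 0 ≤ D := by positivity
  refine ⟨v, hv, M, by positivity, Real.exp D * L, ?_, δ, hδ0, D, min ρ (δ ^ μ), by positivity, ?_⟩
  · exact one_le_mul_of_one_le_of_one_le (Real.one_le_exp hD0) (le_max_left _ _)
  intro ε hε a ha
  have hεabs : |ε| ≤ ρ := (abs_le.2 hε).trans (min_le_left _ _)
  set θ := bigRoot μ ε with hθ
  have hθ0 : 0 ≤ θ := bigRoot_nonneg hμ ε
  have hθδ : θ ≤ δ := by
    have h1 : θ ^ μ ≤ δ ^ μ := by
      rw [hθ, bigRoot_pow hμ]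
      exact max_le (hε.2.trans (min_le_right _ _)) (by positivity)
    exact le_of_pow_le_pow_left₀ (by omega) hδ0.le h1
  have hθρ : θ + δ ≤ ρ := by linarith
  have haA := hKA ha
  have hεI : ε ∈ Icc (-1 : ℝ) 1 := by
    have := abs_le.1 hεabs
    exact ⟨by linarith, by linarith⟩
  have hdP : ∀ x ∈ Icc θ (θ + δ), (N + 1) * |deriv (unfoldingP μ ε) x| ≤ v / 2 := by
    intro x hx
    refine le_trans ?_ hρv
    have := abs_deriv_unfoldingP_le hμ (x := x) ⟨hθ0.trans hx.1, hx.2.trans hθρ⟩ (by linarith) hεabs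
    gcongr
  have hdn : ∀ x ∈ Icc θ (θ + δ), ∀ n ≤ N, n * |deriv (unfoldingP μ ε) x| ≤ v / 2 := by
    intro x hx n hn
    refine le_trans ?_ (hdP x hx)
    have : (n : ℝ) ≤ N := by exact_mod_cast hn
    gcongr
    linarith
  have hPlow : ∀ x ∈ Ioc θ 1, (x - θ) ^ (μ + 1) ≤ unfoldingP μ ε x := fun x hx =>
    pow_le_unfoldingP hμ hx.1
  have hVlow : ∀ x ∈ Icc θ (θ + δ), v ≤ V a x := fun x hx =>
    hvV a ha x ⟨hθ0.trans hx.1, by linarith [hx.2]⟩ (by linarith [hx.2])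
  have hmemI : ∀ x ∈ Icc θ (θ + δ), x ∈ Icc (0 : ℝ) (1 / 2) := fun x hx =>
    ⟨hθ0.trans hx.1, by linarith [hx.2]⟩
  have hMP : ∀ x ∈ Icc θ (θ + δ), ∀ n ≤ N + 1, |iteratedDeriv n (unfoldingP μ ε) x| ≤ M := by
    intro x hx n hn
    have h1 := hmemI x hx
    have := hM₂P n hn (x, ε) ⟨⟨by linarith [h1.1], by linarith [h1.2]⟩, hεI⟩
    exact this.trans (by linarith)
  have hMV' : ∀ x ∈ Icc (0 : ℝ) 1, ∀ n ≤ N + 1, |iteratedDeriv n (V a) x| ≤ M := by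
    intro x hx n hn
    have := hM₁V n hn (x, a) ⟨⟨by linarith [hx.1], hx.2⟩, ha⟩
    exact this.trans (by linarith)
  have hMV : ∀ x ∈ Icc θ (θ + δ), ∀ n ≤ N + 1, |iteratedDeriv n (V a) x| ≤ M :=
    fun x hx => hMV' x ⟨(hmemI x hx).1, by linarith [(hmemI x hx).2]⟩
  have hreg : RegularAbove θ (unfoldingP μ ε) (V a) :=
    ⟨hθ0, fun x hx => (pow_pos (sub_pos.2 hx.1) _).trans_le (hPlow x hx), contDiff_unfoldingP μ ε,
      fun x hx => contDiffAt_V hV haA hx⟩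
  have hPδ : ∀ x ∈ Icc (θ + δ) 1, δ ^ (μ + 1) ≤ unfoldingP μ ε x := by
    intro x hx
    refine le_trans ?_ (hPlow x ⟨by linarith [hx.1], hx.2⟩)
    gcongr
    linarith [hx.1]
  have hdiv : ∀ x ∈ Icc (θ + δ) 1, |V a x / unfoldingP μ ε x| ≤ D := by
    intro x hx
    have h1 := hPδ x hx
    have h2 := hMV' x ⟨by linarith [hx.1], hx.2⟩ 0 (by omega)
    rw [iteratedDeriv_zero] at h2
    have h3 : 0 < δ ^ (μ + 1) := by positivity
    rw [abs_div, abs_of_pos (h3.trans_le h1)]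
    exact div_le_div₀ (by positivity) h2 h3 h1
  have hθmem : θ ∈ Icc θ (θ + δ) := ⟨le_rfl, by linarith⟩
  have hIoc : ∀ {x}, x ∈ Ioc θ (θ + δ) → x ∈ Icc θ (θ + δ) := fun hx => ⟨hx.1.le, hx.2⟩
  have hIoo : ∀ {x}, x ∈ Ioo θ 1 → x ∈ Icc (0 : ℝ) 1 := fun hx => ⟨hθ0.trans hx.1.le, hx.2.le⟩
  refine ⟨by linarith, hreg, hdiv, hMP θ hθmem, hMV θ hθmem, ?_, ?_⟩
  · intro j hj n hn
    rw [iteratedDeriv_zero, iteratedDeriv_one]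
    have h1 := hdn θ hθmem n hn
    have h2 := hVlow θ hθmem
    have h3 : (1 : ℝ) ≤ j := by exact_mod_cast hj
    have h4 : n * deriv (unfoldingP μ ε) θ ≤ n * |deriv (unfoldingP μ ε) θ| := by
      gcongr; exact le_abs_self _
    nlinarith
  · intro q j hj
    have hg : ContDiff ℝ ∞ fun x : ℝ => x ^ q := contDiff_id.pow q
    refine ⟨hj, by linarith, fun x _ => (contDiff_unfoldingP μ ε).contDiffAt,
      fun x hx => contDiffAt_V hV haA (hIoo hx), fun x _ => hg.contDiffAt,
      fun x hx => hreg.contDiffAt_transitTime hg j hx, ?_,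
      fun x hx => hPlow x ⟨hx.1, by linarith [hx.2]⟩, ?_, fun x hx => hVlow x (hIoc hx),
      fun x hx => hdn x (hIoc hx), fun x hx => hMP x (hIoc hx), fun x hx => hMV x (hIoc hx), ?_, ?_⟩
    · intro x hx
      rw [(hreg.hasDerivAt_transitTime hg.continuous j hx).deriv]
      have := (hreg.pos x ⟨hx.1, hx.2.le⟩).ne'
      field_simp
    · intro x hx
      have h1 := Convex.norm_image_sub_le_of_norm_hasDerivWithin_le (C := v / 2)
        (f := unfoldingP μ ε) (f' := deriv (unfoldingP μ ε)) (s := Icc θ (θ + δ)) (x := θ) (y := x)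
        (fun z _ => (hasDerivAt_unfoldingP μ ε z).differentiableAt.hasDerivAt.hasDerivWithinAt)
        (fun z hz => by
          have := hdP z hz
          rw [Real.norm_eq_abs]
          have h5 : (0 : ℝ) ≤ N * |deriv (unfoldingP μ ε) z| := by positivity
          linarith) (convex_Icc _ _) hθmem (hIoc hx)
      rw [hθ, unfoldingP_bigRoot hμ, ← hθ, sub_zero, Real.norm_eq_abs, Real.norm_eq_abs,
        abs_of_pos (sub_pos.2 hx.1)] at h1
      exact (le_abs_self _).trans h1
    · intro x hx n hn
      exact ((abs_iteratedDeriv_pow_le hn (hmemI x (hIoc hx))).trans (hM₃g q)).trans (by linarith)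
    · refine hreg.abs_transitTime_le ⟨by linarith, by linarith⟩ hdiv (fun x hx => ?_)
        (le_max_left _ _) (fun x hx => ?_) hj
      · refine le_trans ?_ (le_max_right _ _)
        exact one_div_le_one_div_of_le (by positivity) (hPδ x hx)
      · have h0 : 0 ≤ x := by linarith [hx.1]
        rw [abs_of_nonneg (by positivity)]
        exact pow_le_one₀ h0 hx.2

end Parameters

/-! ### The coefficients of the expansion -/

section Coefficients

variable {E : Type*}

/-- The `n`-th derivative at `s = 0` of the transit time of the monomial `x ^ q y ^ (j - 1)`. -/
noncomputable def monomialDeriv (μ : ℕ) (ε : ℝ) (W : ℝ → ℝ) (q j n : ℕ) : ℝ :=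
  formalDeriv j (fun i => iteratedDeriv i (unfoldingP μ ε) (bigRoot μ ε))
    (fun i => iteratedDeriv i W (bigRoot μ ε))
    (fun i => iteratedDeriv i (fun x => x ^ q) (bigRoot μ ε)) n

/-- The `n`-th derivative of the Dulac time at `s = 0`, i.e. `n!` times the coefficient `c_n`. Like
`formalDeriv` it is a junk value at resonances, which occur only for large `ε`. -/
noncomputable def dulacDeriv (μ m : ℕ) (V : E → ℝ → ℝ) (u : ℕ → ℕ → E → ℝ) (n : ℕ) (ε : ℝ)
    (a : E) : ℝ :=
  ∑' p : ℕ × ℕ, u p.1 p.2 a * monomialDeriv μ ε (V a) (m + p.1) (p.2 + 1) n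

theorem dulacDeriv_eq_zero (μ : ℕ) {m : ℕ} (V : E → ℝ → ℝ) (u : ℕ → ℕ → E → ℝ) {n : ℕ} (hn : n < m)
    {ε : ℝ} (hε : ε ≤ 0) (a : E) : dulacDeriv μ m V u n ε a = 0 := by
  have h : ∀ p : ℕ × ℕ, monomialDeriv μ ε (V a) (m + p.1) (p.2 + 1) n = 0 := by
    intro p
    refine formalDeriv_eq_zero (m := m) (fun k hk => ?_) hn
    rw [bigRoot_of_nonpos μ hε, iteratedDeriv_pow, zero_pow (by omega), mul_zero]
  simp [dulacDeriv, h]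

theorem UniformData.bound_pow {μ N : ℕ} {v M B δ D ε : ℝ} {W : ℝ → ℝ} (hμ : 1 ≤ μ) (hδ : 0 < δ)
    (h : UniformData μ N v M B δ D ε W) (n q : ℕ) :
    ∀ i ≤ n, |iteratedDeriv i (fun x : ℝ => x ^ q) (bigRoot μ ε)| ≤ powBound n q := fun _ hi =>
  abs_iteratedDeriv_pow_le hi ⟨bigRoot_nonneg hμ ε, by linarith [h.root_add_le]⟩

theorem tendsto_cofinite_powBound (m n : ℕ) (C : ℝ) :
    Tendsto (fun p : ℕ × ℕ => C * (powBound n (m + p.1) / ((p.2 + 1 : ℕ) : ℝ))) cofinite (𝓝 0) := by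
  have h1 : Tendsto (fun i => powBound n (m + i)) cofinite (𝓝 0) := by
    rw [Nat.cofinite_eq_atTop]
    exact (tendsto_powBound n).comp (tendsto_atTop_mono (fun i => Nat.le_add_left i m) tendsto_id)
  have h2 : Tendsto (fun j : ℕ => (((j + 1 : ℕ) : ℝ))⁻¹) cofinite (𝓝 0) := by
    rw [Nat.cofinite_eq_atTop]
    exact tendsto_inv_atTop_zero.comp (tendsto_natCast_atTop_atTop.comp (tendsto_add_atTop_nat 1))
  have h3 := (tendsto_mul_cofinite_nhds_zero h1 h2).const_mul C
  rw [mul_zero] at h3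
  exact h3

variable [NormedAddCommGroup E] [NormedSpace ℝ E]

theorem continuousOn_dulacDeriv {μ N : ℕ} (hμ : 1 ≤ μ) {v M B δ D ε₀ Mu : ℝ} (hv : 0 < v)
    (hM : 0 ≤ M) (hδ : 0 < δ) {A K : Set E} {V : E → ℝ → ℝ}
    (hV : AnalyticOnNhd ℝ (fun p : ℝ × E => V p.2 p.1) (Icc (-1) 1 ×ˢ A)) (hKA : K ⊆ A)
    {u : ℕ → ℕ → E → ℝ} (hu : ∀ i j, ContinuousOn (u i j) A)
    (hsum : ∀ a ∈ A, Summable fun p : ℕ × ℕ => |u p.1 p.2 a|)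
    (hMu : ∀ a ∈ K, ∑' p : ℕ × ℕ, |u p.1 p.2 a| ≤ Mu)
    (h : ∀ ε ∈ Icc (-ε₀) ε₀, ∀ a ∈ K, UniformData μ N v M B δ D ε (V a)) (m : ℕ) {n : ℕ}
    (hn : n ≤ N) :
    ContinuousOn (fun p : ℝ × E => dulacDeriv μ m V u n p.1 p.2) (Icc (-ε₀) ε₀ ×ˢ K) := by
  obtain ⟨C, hC0, hC⟩ := exists_abs_formalDeriv_le (half_pos hv) hM n
  have hroot : Continuous fun p : ℝ × E => bigRoot μ p.1 := (continuous_bigRoot hμ).comp continuous_fst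
  refine continuousOn_tsum_mul (M := Mu) (u := fun (i : ℕ × ℕ) (p : ℝ × E) => u i.1 i.2 p.2)
    (w := fun i p => monomialDeriv μ p.1 (V p.2) (m + i.1) (i.2 + 1) n)
    (bd := fun p : ℕ × ℕ => C * (powBound n (m + p.1) / ((p.2 + 1 : ℕ) : ℝ)))
    (fun i => ((hu i.1 i.2).mono hKA).comp continuousOn_snd fun p hp => hp.2) (fun i => ?_)
    (fun p hp => hsum p.2 (hKA hp.2)) (fun p hp => hMu p.2 hp.2)
    (tendsto_cofinite_powBound m n C) (fun i p hp => ?_)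
  · refine continuousOn_formalDeriv (fun k => ?_) (fun k => ?_) (fun k => ?_) (fun p hp k hk => ?_)
    · exact ((continuous_iteratedDeriv_unfoldingP μ k).comp
        (hroot.prodMk continuous_fst)).continuousOn
    · refine (continuousOn_iteratedDeriv_V hV k).comp
        (f := fun p : ℝ × E => (bigRoot μ p.1, p.2)) (hroot.prodMk continuous_snd).continuousOn
        fun p hp => ⟨?_, hKA hp.2⟩
      have h1 := (h p.1 hp.1 p.2 hp.2).root_add_le
      have h2 := bigRoot_nonneg hμ p.1
      exact ⟨by linarith, by linarith⟩
    · simp only [iteratedDeriv_pow]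
      exact (continuous_const.mul (hroot.pow _)).continuousOn
    · have h1 := (h p.1 hp.1 p.2 hp.2).weight (i.2 + 1) (by omega) k (by omega)
      exact (lt_of_lt_of_le (by positivity) h1).ne'
  · have h1 := h p.1 hp.1 p.2 hp.2
    exact hC (j := i.2 + 1) (by omega) (fun k hk => h1.bound_P k (by omega))
      (fun k hk => h1.bound_V k (by omega)) (h1.bound_pow hμ hδ n _)
      (fun k hk => h1.weight (i.2 + 1) (by omega) k (by omega)) n le_rfl

end Coefficients

/-! ### The expansion -/

/-- The Dulac time and its derivatives near the separatrix, for fixed parameters: the series of the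
transit times of the monomials can be differentiated termwise, up to and including the limit at
`s = 0`. -/
theorem tower_dulacTime {μ N m : ℕ} (hμ : 1 ≤ μ) {v M B δ D ε C δ' Mu : ℝ} {W : ℝ → ℝ}
    (hv : 0 < v) (h : UniformData μ N v M B δ D ε W) (hC0 : 0 ≤ C)
    (hδ' : 0 < δ') (hδδ' : δ' ≤ δ)
    (hC : ∀ {θ : ℝ} {P V g T : ℝ → ℝ} {j : ℕ}, SingularODE μ N v M B δ θ P V g T j →
      ∀ k ≤ N, ∀ x ∈ Ioc θ (θ + δ'), |iteratedDeriv k T x| ≤ C)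
    {u : ℕ × ℕ → ℝ} (hu : Summable fun p => |u p|) (hMu : ∑' p, |u p| ≤ Mu)
    {D' : ℕ → ℝ → ℝ} (hD' : D' = fun n s => ∑' p : ℕ × ℕ, u p * iteratedDeriv n
      (transitTime (unfoldingP μ ε) W (fun x => x ^ (m + p.1)) (p.2 + 1)) (s + bigRoot μ ε)) :
    (∀ n < N, ∀ s ∈ Ioo 0 δ', HasDerivAt (D' n) (D' (n + 1) s) s) ∧
    (∀ n ≤ N, ∀ s ∈ Ioo 0 δ', |D' n s| ≤ C * Mu) ∧
    (∀ n < N, Tendsto (D' n) (𝓝[>] 0)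
      (𝓝 (∑' p : ℕ × ℕ, u p * monomialDeriv μ ε W (m + p.1) (p.2 + 1) n))) := by
  set θ := bigRoot μ ε with hθ
  have hode := fun p : ℕ × ℕ => h.singularODE (m + p.1) (p.2 + 1) (by omega)
  have hmem : ∀ s ∈ Ioo 0 δ', s + θ ∈ Ioc θ (θ + δ') := fun s hs =>
    ⟨by linarith [hs.1], by linarith [hs.2]⟩
  have hb : ∀ n ≤ N, ∀ s ∈ Ioo 0 δ', ∀ p : ℕ × ℕ, ‖u p * iteratedDeriv n
      (transitTime (unfoldingP μ ε) W (fun x => x ^ (m + p.1)) (p.2 + 1)) (s + θ)‖ ≤ |u p| * C := by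
    intro n hn s hs p
    rw [Real.norm_eq_abs, abs_mul]
    exact mul_le_mul_of_nonneg_left (hC (hode p) n hn _ (hmem s hs)) (abs_nonneg _)
  have hsC := hu.mul_right C
  subst hD'
  refine ⟨fun n hn s hs => ?_, fun n hn s hs => ?_, fun n hn => ?_⟩
  · refine hasDerivAt_tsum_of_isPreconnected (u := fun p => |u p| * C) hsC isOpen_Ioo
      isPreconnected_Ioo (g := fun p s => u p * iteratedDeriv n
        (transitTime (unfoldingP μ ε) W (fun x => x ^ (m + p.1)) (p.2 + 1)) (s + θ))
      (g' := fun p s => u p * iteratedDeriv (n + 1)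
        (transitTime (unfoldingP μ ε) W (fun x => x ^ (m + p.1)) (p.2 + 1)) (s + θ))
      (fun p z hz => ?_) (fun p z hz => hb (n + 1) hn z hz p) hs
      (Summable.of_norm_bounded hsC (hb n hn.le s hs)) hs
    have h1 := hmem z hz
    have h2 := (hode p).hasDerivAt n ((hode p).mem_Ioo ⟨h1.1, h1.2.trans (by linarith)⟩)
    exact (h2.comp_add_const z θ).const_mul _
  · rw [← Real.norm_eq_abs]
    refine (tsum_of_norm_bounded hsC.hasSum (hb n hn s hs)).trans ?_
    rw [tsum_mul_right, mul_comm]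
    gcongr
  · refine tendsto_tsum_of_dominated_convergence hsC (fun p => ?_)
      (mem_of_superset (Ioo_mem_nhdsGT hδ') fun s hs => hb n hn.le s hs)
    refine Tendsto.const_mul _ ?_
    have hnn := h.regular.nonneg
    have h1 := (hode p).tendsto_iteratedDeriv (n := n) hδ' hδδ' hv
      (contDiff_unfoldingP μ ε).contDiffAt
      (h.regular.contDiffAt_V θ ⟨hnn, by
        have := h.root_add_le; linarith⟩)
      (contDiff_id.pow (m + p.1)).contDiffAt (unfoldingP_bigRoot hμ ε) hn (hC (hode p))
    refine h1.comp (tendsto_nhdsWithin_iff.2 ⟨?_, ?_⟩)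
    · have h2 : Tendsto (fun s : ℝ => s + θ) (𝓝 0) (𝓝 (0 + θ)) :=
        (continuous_id.add continuous_const).tendsto 0
      rw [zero_add] at h2
      exact h2.mono_left nhdsWithin_le_nhds
    · filter_upwards [self_mem_nhdsWithin] with s hs
      have : (0 : ℝ) < s := hs
      exact mem_Ioi.2 (by linarith)

end DulacTime

open DulacTime

theorem corollaryB (μ m α : ℕ) (hμ : 1 ≤ μ)
    (A : Set (EuclideanSpace ℝ (Fin α))) (hA : IsOpen A)
    (V : EuclideanSpace ℝ (Fin α) → ℝ → ℝ)
    (hV : AnalyticOnNhd ℝ (fun p : ℝ × EuclideanSpace ℝ (Fin α) => V p.2 p.1)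
      (Set.Icc (-1) 1 ×ˢ A))
    (hV0 : ∀ a ∈ A, 0 < V a 0)
    (Ubar : EuclideanSpace ℝ (Fin α) → ℝ → ℝ → ℝ)
    (hU : DulacTime.IsAbsConvTaylorFamily A Ubar) :
    ∃ c : ℕ → ℝ → EuclideanSpace ℝ (Fin α) → ℝ,
      (∀ j < m, ∀ ε ≤ (0 : ℝ), ∀ a ∈ A, c j ε a = 0) ∧
      ∀ (l k : ℕ) (K : Set (EuclideanSpace ℝ (Fin α))), IsCompact K → K ⊆ A →
        ∃ ε₀ > (0 : ℝ),
          (∀ j ≤ l, ContinuousOn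
            (fun p : ℝ × EuclideanSpace ℝ (Fin α) => c j p.1 p.2) (Set.Icc (-ε₀) ε₀ ×ˢ K)) ∧
          ∃ h : ℝ → ℝ → EuclideanSpace ℝ (Fin α) → ℝ,
            -- the Dulac time, wherever it is defined, has the expansion with remainder `s ^ l * h`
            (∀ ε ∈ Set.Icc (-ε₀) ε₀, ∀ a ∈ K, ∀ s > 0, s + DulacTime.bigRoot μ ε ≤ 1 → ∀ τ : ℝ,
              DulacTime.IsDulacTime (DulacTime.unfoldingP μ ε) (V a)
                (fun x y => x ^ m * Ubar a x y) (s + DulacTime.bigRoot μ ε) τ →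
              τ = ∑ j ∈ Finset.range (l + 1), c j ε a * s ^ j + s ^ l * h s ε a) ∧
            -- uniformly in the parameters, it is defined for small `s` and `h` is regular there
            (∃ s₀ > (0 : ℝ), ∀ ε ∈ Set.Icc (-ε₀) ε₀, ∀ a ∈ K,
              s₀ + DulacTime.bigRoot μ ε ≤ 1 ∧
              (∀ s ∈ Set.Ioo 0 s₀, ∃ τ : ℝ,
                DulacTime.IsDulacTime (DulacTime.unfoldingP μ ε) (V a)
                  (fun x y => x ^ m * Ubar a x y) (s + DulacTime.bigRoot μ ε) τ) ∧
              ContDiffOn ℝ k (fun s => h s ε a) (Set.Ioo 0 s₀)) ∧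
            -- uniform flatness
            ∀ r ≤ k, TendstoUniformlyOn
              (fun (s : ℝ) (p : ℝ × EuclideanSpace ℝ (Fin α)) =>
                (DulacTime.eulerOp^[r] (fun σ => h σ p.1 p.2)) s)
              (fun _ => 0) (nhdsWithin 0 (Set.Ioi 0)) (Set.Icc (-ε₀) ε₀ ×ˢ K) := by
  obtain ⟨u, huc, hus, huM, huF⟩ := hU
  refine ⟨fun n ε a => dulacDeriv μ m V u n ε a / n.factorial, ?_, ?_⟩
  · intro j hj ε hε a _
    simp only [dulacDeriv_eq_zero μ V u hj hε a, zero_div]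
  intro l k K hK hKA
  -- `k` derivatives of a remainder which begins at the order `l + 1`
  set N := l + k + 1 with hN
  obtain ⟨v, hv, M, hM, B, hB, δ, hδ, D, ε₀, hε₀, hdata⟩ :=
    exists_uniformData hμ hV hV0 hK hKA N
  obtain ⟨Mu, hMu⟩ := huM K hKA hK
  obtain ⟨C, hC0, δ', hδ', hδδ', hC⟩ := SingularODE.exists_bound μ N hv hM hB hδ N le_rfl
  set s₀ : ℝ := min δ' (δ / Real.exp D) with hs₀
  have hs₀pos : 0 < s₀ := lt_min hδ' (div_pos hδ (Real.exp_pos D))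
  have hs₀δ' : s₀ ≤ δ' := min_le_left _ _
  set T : ℝ → ℝ → EuclideanSpace ℝ (Fin α) → ℝ := fun s ε a => Classical.epsilon fun τ =>
    IsDulacTime (unfoldingP μ ε) (V a) (fun x y => x ^ m * Ubar a x y) (s + bigRoot μ ε) τ with hT
  -- the remainder is defined by the Dulac time itself, which is unique wherever it exists; where it
  -- does not exist, `T` is an arbitrary number on which nothing is claimed
  set h : ℝ → ℝ → EuclideanSpace ℝ (Fin α) → ℝ := fun s ε a => (T s ε a
    - ∑ j ∈ Finset.range (l + 1), dulacDeriv μ m V u j ε a / j.factorial * s ^ j) / s ^ l with hh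
  have hTeq : ∀ ε ∈ Icc (-ε₀) ε₀, ∀ a ∈ K, ∀ s > 0, s + bigRoot μ ε ≤ 1 → ∀ τ : ℝ,
      IsDulacTime (unfoldingP μ ε) (V a) (fun x y => x ^ m * Ubar a x y) (s + bigRoot μ ε) τ →
      T s ε a = τ := by
    intro ε hε a ha s hs hs1 τ hτ
    exact (hdata ε hε a ha).regular.dulacTime_unique ⟨by linarith, hs1⟩
      (Classical.epsilon_spec (p := fun τ => IsDulacTime (unfoldingP μ ε) (V a)
        (fun x y => x ^ m * Ubar a x y) (s + bigRoot μ ε) τ) ⟨τ, hτ⟩) hτ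
  have hs₀1 : ∀ ε ∈ Icc (-ε₀) ε₀, ∀ a ∈ K, s₀ + bigRoot μ ε ≤ 1 := fun ε hε a ha => by
    have := (hdata ε hε a ha).root_add_le
    linarith
  have hdef : ∀ ε ∈ Icc (-ε₀) ε₀, ∀ a ∈ K, ∀ s ∈ Ioo 0 s₀,
      IsDulacTime (unfoldingP μ ε) (V a) (fun x y => x ^ m * Ubar a x y) (s + bigRoot μ ε)
        (∑' p : ℕ × ℕ, u p.1 p.2 a * transitTime (unfoldingP μ ε) (V a) (fun x => x ^ (m + p.1))
          (p.2 + 1) (s + bigRoot μ ε)) := by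
    intro ε hε a ha s hs
    have hd := hdata ε hε a ha
    have hroot := hd.root_add_le
    have hnn := hd.regular.nonneg
    have hode := hd.singularODE 0 1 le_rfl
    refine hd.regular.isDulacTime_tsum ⟨by linarith [hs.1], by linarith [hs.2, hs₀1 ε hε a ha]⟩
      (fun x hx => ?_) m (u := fun p => u p.1 p.2 a) (hus a (hKA ha)) (huF a (hKA ha))
    refine hd.regular.orbitY_le_one (b := bigRoot μ ε + δ) ⟨by linarith, by linarith⟩ hv
      hd.abs_div_le hode.le_V hode.le_mul ⟨by linarith [hs.1], by linarith [hs.2]⟩ ?_ hx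
    rw [add_sub_cancel_right, add_sub_cancel_left, ← le_div_iff₀ (Real.exp_pos D)]
    exact hs.2.le.trans (min_le_right _ _)
  have hmain : ∀ ε ∈ Icc (-ε₀) ε₀, ∀ a ∈ K, ContDiffOn ℝ k (fun s => h s ε a) (Ioo 0 s₀) ∧
      ∀ r ≤ k, ∀ s ∈ Ioo 0 s₀,
        |(eulerOp^[r] fun σ => h σ ε a) s| ≤ eulerConst l r * (C * Mu * s) := by
    intro ε hε a ha
    have hd := hdata ε hε a ha
    obtain ⟨h1, h2, h3⟩ := tower_dulacTime (m := m) hμ hv hd hC0 hδ' hδδ' hC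
      (u := fun p => u p.1 p.2 a) (hus a (hKA ha)) (hMu a ha) rfl
    have hsub : ∀ {s}, s ∈ Ioo 0 s₀ → s ∈ Ioo 0 δ' := fun hs => ⟨hs.1, hs.2.trans_le hs₀δ'⟩
    refine remainder_of_tower (d := fun n => dulacDeriv μ m V u n ε a)
      (by linarith [hs₀1 ε hε a ha, hd.regular.nonneg])
      (fun n hn s hs => h1 n hn s (hsub hs)) (fun n hn s hs => h2 n hn s (hsub hs))
      (fun n hn => h3 n (by omega)) (fun s hs => ?_)
    simp only [hh, iteratedDeriv_zero]
    rw [hTeq ε hε a ha s hs.1 (by linarith [hs.2, hs₀1 ε hε a ha]) _ (hdef ε hε a ha s hs)]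
  refine ⟨ε₀, hε₀, fun j hj => ?_, h, ?_, ⟨s₀, hs₀pos, fun ε hε a ha => ⟨hs₀1 ε hε a ha,
    fun s hs => ⟨_, hdef ε hε a ha s hs⟩, (hmain ε hε a ha).1⟩⟩, fun r hr => ?_⟩
  · exact (continuousOn_dulacDeriv hμ hv hM hδ hV hKA huc hus hMu hdata m (by omega)).div_const _
  · intro ε hε a ha s hs hs1 τ hτ
    simp only [hh]
    rw [hTeq ε hε a ha s hs hs1 τ hτ, mul_div_cancel₀ _ (pow_pos hs l).ne']
    ring
  · rw [Metric.tendstoUniformlyOn_iff]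
    intro η hη
    have hlim : Tendsto (fun s : ℝ => eulerConst l r * (C * Mu * s)) (𝓝[>] 0) (𝓝 0) := by
      have : Tendsto (fun s : ℝ => eulerConst l r * (C * Mu * s)) (𝓝 0)
          (𝓝 (eulerConst l r * (C * Mu * 0))) := by
        refine Continuous.tendsto ?_ 0
        fun_prop
      rw [mul_zero, mul_zero] at this
      exact this.mono_left nhdsWithin_le_nhds
    filter_upwards [hlim.eventually (gt_mem_nhds hη), Ioo_mem_nhdsGT hs₀pos] with s hs1 hs2 p hp
    rw [dist_comm, Real.dist_eq, sub_zero]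
    exact ((hmain p.1 hp.1 p.2 hp.2).2 r hr s hs2).trans_lt hs1
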